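/- Let $K$ be a field of characteristic zero (e.g. $\mathbb C$). Signs $(-1)^{o}$ use the degree of a homogeneous element $o$. **$A_\infty$-algebras.** An $A_\infty$-algebra $(\mathcal H,\mathfrak m)$ is a $\mathbb Z$-graded $K$-vector space $\mathcal H$ (of any dimension) with multilinear maps $m_k:\mathcal H^{\otimes k}\to\mathcal H$, $k\ge 1$, of degree $+1$ such that for all $n\ge 1$ and homogeneous $o_1,\dots,o_n$ $$\sum_{k+l=n+1,\ l\ge 1}\ \sum_{j=0}^{k-1}(-1)^{o_1+\cdots+o_j}\,m_k(o_1,\dots,o_j,m_l(o_{j+1},\dots,o_{j+l}),o_{j+l+1},\dots,o_n)=0 .$$ It is minimal if $m_1=0$. An $A_\infty$-morphism $\{f_k\}_{k\ge1}:(\mathcal H,\mathfrak m)\to(\mathcal H',\mathfrak m')$ consists of multilinear maps $f_k:\mathcal H^{\otimes k}\to\mathcal H'$ of degree $0$ with $$\sum_{i\ge1}\ \sum_{b_1+\cdots+b_i=n,\ b_s\ge1} m'_i(f_{b_1}\otimes\cdots\otimes f_{b_i})(o_1,\dots,o_n)=\sum_{k+l=n+1,\ l\ge 1}\ \sum_{j=0}^{k-1}(-1)^{o_1+\cdots+o_j}f_k(o_1,\dots,o_j,m_l(o_{j+1},\dots,o_{j+l}),\dots,o_n)$$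 for all $n\ge 1$ and homogeneous $o_1,\dots,o_n$; it is an $A_\infty$-quasi-isomorphism if $f_1$ induces an isomorphism from the cohomology of $(\mathcal H,m_1)$ to that of $(\mathcal H',m_1')$. **Cyclic structures.** An odd symplectic structure on $\mathcal H$ is a bilinear form $\omega$ with values in $K$ such that, for homogeneous $o,o'$, $\omega(o,o')\neq0$ only if $\deg o+\deg o'=1$, with $\omega(o',o)=-\omega(o,o')$, and such that for every $o\ne0$ there is $o'$ with $\omega(o,o')\ne0$. A cyclic $A_\infty$-algebra $(\mathcal H,\omega,\mathfrak m)$ is an $A_\infty$-algebra with an odd symplectic structure such that for all $k\ge1$ and homogeneous $o_1,\dots,o_{k+1}$ $$\omega(o_1,m_k(o_2,\dots,o_{k+1}))=(-1)^{o_2}\,\omega(o_2,m_k(o_3,\dots,o_{k+1},o_1)).$$ An $A_\infty$-(quasi-iso)morphism $\{f_k\}$ between cyclic $A_\infty$-algebras is cyclic if $\omega'(f_1(o),f_1(o'))=\omega(o,o')$ for all $o,o'$, and for every $n\ge3$ and all $o_1,\dots,o_n$ $$\sum_{k,l\ge1,\ k+l=n}\omega'\bigl(f_k(o_1,\dots,o_k),f_l(o_{k+1},\dots,o_n)\bigr)=0.$$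 **Homotopy operator.** Let $(\mathcal H,\omega,\mathfrak m)$ be a cyclic $A_\infty$-algebra and $Q:=m_1$. Let a Hodge–Kodaira decomposition be given: a graded vector space $\mathcal H^p$, degree-$0$ linear maps $\iota:\mathcal H^p\to\mathcal H$, $\pi:\mathcal H\to\mathcal H^p$ and a degree $-1$ linear map $Q^+:\mathcal H\to\mathcal H$ with $$\pi\iota=\mathrm{id},\qquad Q\iota=0,\qquad \pi Q=0,\qquad QQ^++Q^+Q+P=\mathrm{id}\ \text{ with } P:=\iota\pi,$$ and such that $Q^+$ takes its values in $\mathcal H^u:=Q^+Q\mathcal H$, i.e. $Q^+QQ^+=Q^+$ (equivalently, $Q^+Q^+=0$, $Q^+\iota=0$, $\pi Q^+=0$). Suppose $Q^+$ is compatible with $\omega$, that is, $\omega(P\mathcal H,\mathcal H^u)=\omega(\mathcal H^u,\mathcal H^u)=0$. **Explicit maps.** Define $\tilde f^p_k:(\mathcal H^p)^{\otimes k}\to\mathcal H$ recursively by $\tilde f^p_1=\iota$ and, for $k\ge2$, $$\tilde f^p_k=-Q^+\sum_{i\ge2}\ \sum_{b_1+\cdots+b_i=k,\ b_s\ge1}m_i(\tilde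 f^p_{b_1}\otimes\cdots\otimes\tilde f^p_{b_i}),$$ and define $\tilde m^p_k:(\mathcal H^p)^{\otimes k}\to\mathcal H^p$ by $\tilde m^p_1=0$ and, for $k\ge2$, $$\tilde m^p_k=\pi\sum_{i\ge2}\ \sum_{b_1+\cdots+b_i=k,\ b_s\ge1}m_i(\tilde f^p_{b_1}\otimes\cdots\otimes\tilde f^p_{b_i}).$$ Let $\tilde\omega^p:=\omega(\iota\otimes\iota)$. **Lemma.** (a) $(\mathcal H^p,\tilde\omega^p,\tilde{\mathfrak m}^p)$ is a minimal cyclic $A_\infty$-algebra; in particular $\tilde{\mathfrak m}^p$ is an $A_\infty$-structure, $\tilde\omega^p$ is an odd symplectic structure, and $\tilde{\mathfrak m}^p$ is cyclic with respect to $\tilde\omega^p$. (b) $\tilde{\mathcal F}^p=\{\tilde f^p_k\}_{k\ge1}:(\mathcal H^p,\tilde\omega^p,\tilde{\mathfrak m}^p)\to(\mathcal H,\omega,\mathfrak m)$ is a cyclic $A_\infty$-quasi-isomorphism. -/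

import Mathlib

namespace AInfinity

variable {K : Type*} [Field K]
variable {U V W : Type*} [AddCommGroup U] [Module K U] [AddCommGroup V] [Module K V]
  [AddCommGroup W] [Module K W]

/-- A collection of multilinear maps `m_k : V^{⊗k} → W`, one for each `k ≥ 0`. -/
abbrev Ops (K V W : Type*) [Field K] [AddCommGroup V] [Module K V] [AddCommGroup W] [Module K W] :=
  ∀ k : ℕ, MultilinearMap K (fun _ : Fin k => V) W

/-- All `m_k` are homogeneous of degree `e`, for the gradings `𝒜` of `V` and `ℬ` of `W`. -/
def Ops.HasDegree (𝒜 : ℤ → Submodule K V) (ℬ : ℤ → Submodule K W) (e : ℤ) (m : Ops K V W) : Prop :=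
  ∀ (k : ℕ) (d : Fin k → ℤ) (o : Fin k → V), (∀ i, o i ∈ 𝒜 (d i)) → m k o ∈ ℬ (∑ i, d i + e)

/-- A linear map that is homogeneous of degree `e`. -/
def LinHasDegree (𝒜 : ℤ → Submodule K V) (ℬ : ℤ → Submodule K W) (e : ℤ) (f : V →ₗ[K] W) : Prop :=
  ∀ (d : ℤ) (x : V), x ∈ 𝒜 d → f x ∈ ℬ (d + e)

/-- The component `m_1` as a linear map. -/
def Ops.lin (m : Ops K V W) : V →ₗ[K] W :=
  (MultilinearMap.ofSubsingleton K V W (0 : Fin 1)).symm (m 1)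

/-- The sequence `o_0, …, o_{j-1}, x, o_{j+l}, o_{j+l+1}, …`: the `l` entries of `o` from position
`j` on are replaced by the single entry `x` (used for `l ≥ 1`). -/
def splice (o : ℕ → V) (j l : ℕ) (x : V) : ℕ → V := fun i =>
  if i < j then o i else if i = j then x else o (i + l - 1)

/-- With arguments numbered from `0`, the sum over `k + l = n + 1`, `l ≥ 1`, `0 ≤ j ≤ k - 1` of
`(-1)^{|o_0| + ⋯ + |o_{j-1}|} f_k(o_0, …, o_{j-1}, m_l(o_j, …, o_{j+l-1}), o_{j+l}, …, o_{n-1})`,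
where `d i` is the degree of `o i`. Only the first `n` entries of `o` and `d` are used. -/
def insertSum (f : Ops K V W) (m : Ops K V V) (n : ℕ) (d : ℕ → ℤ) (o : ℕ → V) : W :=
  ∑ l ∈ Finset.Icc 1 n, ∑ j ∈ Finset.range (n - l + 1),
    (-1 : K) ^ (∑ i ∈ Finset.range j, d i) •
      f (n - l + 1) (fun i => splice o j l (m l (fun s => o (j + s))) i)

/-- For a composition `n = b_1 + ⋯ + b_i`, the multilinear map `g (f_1 ⊗ ⋯ ⊗ f_i)`, the map `f_s`
being applied to the `s`-th block of `b_s` consecutive arguments. -/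
def compAlong {n : ℕ} (c : Composition n) (g : MultilinearMap K (fun _ : Fin c.length => W) U)
    (f : ∀ i : Fin c.length, MultilinearMap K (fun _ : Fin (c.blocksFun i) => V) W) :
    MultilinearMap K (fun _ : Fin n => V) U where
  toFun v := g (fun i => f i (v ∘ c.embedding i))
  map_update_add' := by
    intro _ v i x y
    have key : ∀ z : V, (fun r => f r (Function.update v i z ∘ c.embedding r)) =
        Function.update (fun r => f r (v ∘ c.embedding r)) (c.index i)
          (f (c.index i) (Function.update (v ∘ c.embedding (c.index i)) (c.invEmbedding i) z)) := by
      intro z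
      funext r
      by_cases h : r = c.index i
      · subst h
        rw [Function.update_self]
        congr 1
        have hi := c.embedding_comp_inv i
        funext s
        by_cases hs : s = c.invEmbedding i
        · subst hs
          simp [hi]
        · have : c.embedding (c.index i) s ≠ i := fun h' =>
            hs ((c.embedding (c.index i)).injective (h'.trans hi.symm))
          simp [Function.update_of_ne hs, Function.update_of_ne this]
      · rw [Function.update_of_ne h]
        congr 1
        funext s
        have : c.embedding r s ≠ i := by
          rintro rfl
          exact h (c.index_embedding r s).symm
        simp [Function.update_of_ne this]
    have e : ‹DecidableEq (Fin n)› = instDecidableEqFin n := Subsingleton.elim _ _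
    subst e
    simp only [key, MultilinearMap.map_update_add]
  map_update_smul' := by
    intro _ v i a x
    have key : ∀ z : V, (fun r => f r (Function.update v i z ∘ c.embedding r)) =
        Function.update (fun r => f r (v ∘ c.embedding r)) (c.index i)
          (f (c.index i) (Function.update (v ∘ c.embedding (c.index i)) (c.invEmbedding i) z)) := by
      intro z
      funext r
      by_cases h : r = c.index i
      · subst h
        rw [Function.update_self]
        congr 1
        have hi := c.embedding_comp_inv i
        funext s
        by_cases hs : s = c.invEmbedding i
        · subst hs
          simp [hi]
        · have : c.embedding (c.index i) s ≠ i := fun h' =>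
            hs ((c.embedding (c.index i)).injective (h'.trans hi.symm))
          simp [Function.update_of_ne hs, Function.update_of_ne this]
      · rw [Function.update_of_ne h]
        congr 1
        funext s
        have : c.embedding r s ≠ i := by
          rintro rfl
          exact h (c.index_embedding r s).symm
        simp [Function.update_of_ne this]
    have e : ‹DecidableEq (Fin n)› = instDecidableEqFin n := Subsingleton.elim _ _
    subst e
    simp only [key, MultilinearMap.map_update_smul]

/-! ### `A_∞`-algebras and their morphisms -/

/-- `A_∞`-algebra structure on `V` with grading `𝒜` (degree-one maps, `m_0 = 0`). -/
structure IsAInfty (𝒜 : ℤ → Submodule K V) (m : Ops K V V) : Prop where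
  degree : m.HasDegree 𝒜 𝒜 1
  zero : m 0 = 0
  relation : ∀ (n : ℕ) (d : ℕ → ℤ) (o : ℕ → V), 1 ≤ n → (∀ i, o i ∈ 𝒜 (d i)) →
    insertSum m m n d o = 0

/-- An `A_∞`-algebra is minimal if `m_1 = 0`. -/
def IsMinimal (m : Ops K V V) : Prop := m.lin = 0

/-- `A_∞`-morphism `f = {f_k}` from `(V, m)` to `(W, m')`: maps of degree zero with `f_0 = 0` and
`∑ m'_i (f_{k_1} ⊗ ⋯ ⊗ f_{k_i}) = ∑ ± f_k (1 ⊗ ⋯ ⊗ m_l ⊗ ⋯ ⊗ 1)`. -/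
structure IsAInftyMorphism (𝒜 : ℤ → Submodule K V) (m : Ops K V V)
    (ℬ : ℤ → Submodule K W) (m' : Ops K W W) (f : Ops K V W) : Prop where
  degree : f.HasDegree 𝒜 ℬ 0
  zero : f 0 = 0
  relation : ∀ (n : ℕ) (d : ℕ → ℤ) (o : ℕ → V), 1 ≤ n → (∀ i, o i ∈ 𝒜 (d i)) →
    ∑ c : Composition n, compAlong c (m' c.length) (fun i => f (c.blocksFun i))
      (fun i : Fin n => o i) = insertSum f m n d o

/-- Cohomology `ker Q / im Q` of a differential. -/
abbrev Cohomology (Q : V →ₗ[K] V) : Type _ :=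
  LinearMap.ker Q ⧸ (LinearMap.range Q).comap (LinearMap.ker Q).subtype

/-- The map induced on cohomology by a chain map. -/
def cohomologyMap (Q : V →ₗ[K] V) (Q' : W →ₗ[K] W) (f : V →ₗ[K] W) (hf : f ∘ₗ Q = Q' ∘ₗ f) :
    Cohomology Q →ₗ[K] Cohomology Q' :=
  Submodule.mapQ _ _
    (f.restrict (p := LinearMap.ker Q) (q := LinearMap.ker Q') (by
      intro x hx
      have h := LinearMap.congr_fun hf x
      simp only [LinearMap.comp_apply, LinearMap.mem_ker.mp hx, map_zero] at h
      exact LinearMap.mem_ker.mpr h.symm))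
    (by
      rintro ⟨x, hx⟩ ⟨y, hy⟩
      exact ⟨f y, by
        have h := LinearMap.congr_fun hf y
        simp only [LinearMap.comp_apply, Submodule.subtype_apply] at h hy ⊢
        rw [← h, hy]
        rfl⟩)

/-- The chain map `f` induces an isomorphism on cohomology. -/
def InducesCohomologyIso (Q : V →ₗ[K] V) (Q' : W →ₗ[K] W) (f : V →ₗ[K] W) : Prop :=
  ∃ hf : f ∘ₗ Q = Q' ∘ₗ f, Function.Bijective (cohomologyMap Q Q' f hf)

/-- `A_∞`-quasi-isomorphism: an `A_∞`-morphism whose `f_1` induces an isomorphism on cohomology. -/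
structure IsAInftyQuasiIso (𝒜 : ℤ → Submodule K V) (m : Ops K V V)
    (ℬ : ℤ → Submodule K W) (m' : Ops K W W) (f : Ops K V W) : Prop
    extends IsAInftyMorphism 𝒜 m ℬ m' f where
  quasiIso : InducesCohomologyIso m.lin m'.lin f.lin

/-! ### Cyclic structures -/

/-- Odd constant symplectic structure: a nondegenerate skewsymmetric form of degree minus one. -/
structure IsOddSymplectic (𝒜 : ℤ → Submodule K V) (ω : V →ₗ[K] V →ₗ[K] K) : Prop where
  degree : ∀ (p q : ℤ) (a b : V), a ∈ 𝒜 p → b ∈ 𝒜 q → ω a b ≠ 0 → p + q = 1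
  skew : ∀ a b : V, ω b a = -ω a b
  nondegenerate : ∀ a : V, a ≠ 0 → ∃ b : V, ω a b ≠ 0

/-- Cyclic `A_∞`-algebra `(V, ω, m)`. The arguments are `o_0, …, o_k` with indices modulo `k + 1`,
so that `fun i => o (i.succ + 1)` is `o_2, …, o_k, o_0`. -/
structure IsCyclicAInfty (𝒜 : ℤ → Submodule K V) (ω : V →ₗ[K] V →ₗ[K] K) (m : Ops K V V) : Prop
    extends IsAInfty 𝒜 m where
  symplectic : IsOddSymplectic 𝒜 ω
  cyclic : ∀ (k : ℕ) (d : Fin (k + 1) → ℤ) (o : Fin (k + 1) → V), 1 ≤ k → (∀ i, o i ∈ 𝒜 (d i)) →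
    ω (o 0) (m k (fun i => o i.succ)) = (-1 : K) ^ d 1 * ω (o 1) (m k (fun i => o (i.succ + 1)))

/-- The two conditions on an `A_∞`-morphism `f` that make it cyclic. -/
structure PreservesForms (ω : V →ₗ[K] V →ₗ[K] K) (ω' : W →ₗ[K] W →ₗ[K] K) (f : Ops K V W) :
    Prop where
  linear : ∀ a b : V, ω' (f.lin a) (f.lin b) = ω a b
  higher : ∀ (n : ℕ) (o : ℕ → V), 3 ≤ n →
    ∑ k ∈ Finset.Icc 1 (n - 1),
      ω' (f k (fun i => o i)) (f (n - k) (fun i => o (k + i))) = 0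

/-- Cyclic `A_∞`-quasi-isomorphism between cyclic `A_∞`-algebras. -/
structure IsCyclicAInftyQuasiIso (𝒜 : ℤ → Submodule K V) (ω : V →ₗ[K] V →ₗ[K] K) (m : Ops K V V)
    (ℬ : ℤ → Submodule K W) (ω' : W →ₗ[K] W →ₗ[K] K) (m' : Ops K W W) (f : Ops K V W) : Prop
    extends IsAInftyQuasiIso 𝒜 m ℬ m' f where
  source : IsCyclicAInfty 𝒜 ω m
  target : IsCyclicAInfty ℬ ω' m'
  forms : PreservesForms ω ω' f

/-! ### Hodge–Kodaira decompositions and the explicit minimal model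

`V` is the whole space with differential `Q`, and `W` is the space `H^p` of physical states. -/

/-- A Hodge–Kodaira decomposition `Q Q⁺ + Q⁺ Q + P = 1`, `P = ι π`, given by a splitting of the
complex `(V, Q)` onto `(W, 0)` with contracting homotopy `Q⁺`. The field `image` says that `Q⁺`
takes its values in the subspace `Q⁺ Q V` of unphysical states; given the other fields it is
equivalent to the usual side conditions `Q⁺ Q⁺ = 0`, `Q⁺ ι = 0`, `π Q⁺ = 0` of a strong
deformation retract. -/
structure IsHodgeKodaira (𝒜 : ℤ → Submodule K V) (ℬ : ℤ → Submodule K W) (Q : V →ₗ[K] V)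
    (ι : W →ₗ[K] V) (π : V →ₗ[K] W) (Qp : V →ₗ[K] V) : Prop where
  degree_ι : LinHasDegree ℬ 𝒜 0 ι
  degree_π : LinHasDegree 𝒜 ℬ 0 π
  degree_Qp : LinHasDegree 𝒜 𝒜 (-1) Qp
  π_ι : π ∘ₗ ι = LinearMap.id
  Q_ι : Q ∘ₗ ι = 0
  π_Q : π ∘ₗ Q = 0
  decomposition : Q ∘ₗ Qp + Qp ∘ₗ Q + ι ∘ₗ π = LinearMap.id
  image : Qp ∘ₗ Q ∘ₗ Qp = Qp

/-- `Q⁺` is compatible with `ω`: `ω(H^p, H^u) = ω(H^u, H^u) = 0` where `H^p = P V`, `P = ι π`, and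
`H^u = Q⁺ Q V`. -/
def IsCompatible (ω : V →ₗ[K] V →ₗ[K] K) (Q : V →ₗ[K] V) (ι : W →ₗ[K] V) (π : V →ₗ[K] W)
    (Qp : V →ₗ[K] V) : Prop :=
  (∀ x ∈ LinearMap.range (ι ∘ₗ π), ∀ y ∈ LinearMap.range (Qp ∘ₗ Q), ω x y = 0) ∧
  (∀ x ∈ LinearMap.range (Qp ∘ₗ Q), ∀ y ∈ LinearMap.range (Qp ∘ₗ Q), ω x y = 0)

theorem blocksFun_lt {n : ℕ} (c : Composition n) (hc : 2 ≤ c.length) (i : Fin c.length) :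
    c.blocksFun i < n := by
  have hsum := c.sum_blocksFun
  obtain ⟨j, hj⟩ : ∃ j : Fin c.length, j ≠ i := by
    have : Nontrivial (Fin c.length) := Fin.nontrivial_iff_two_le.mpr hc
    exact exists_ne i
  have h1 := c.one_le_blocksFun j
  have h2 : ∑ s ∈ {i, j}, c.blocksFun s ≤ ∑ s, c.blocksFun s :=
    Finset.sum_le_sum_of_subset (Finset.subset_univ _)
  rw [Finset.sum_pair hj.symm] at h2
  omega

/-- The maps `f̃_k : W^{⊗k} → V`: `f̃_1 = ι` and, for `k ≥ 2`,
`f̃_k = -Q⁺ ∑_{i ≥ 2} ∑_{b_1 + ⋯ + b_i = k} m_i (f̃_{b_1} ⊗ ⋯ ⊗ f̃_{b_i})`. -/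
noncomputable def explicitMorphism (m : Ops K V V) (ι : W →ₗ[K] V) (Qp : V →ₗ[K] V) : Ops K W V
  | 0 => 0
  | 1 => MultilinearMap.ofSubsingleton K W V (0 : Fin 1) ι
  | k + 2 => -Qp.compMultilinearMap (∑ c : {c : Composition (k + 2) // 2 ≤ c.length},
      compAlong c.1 (m c.1.length)
        (fun i => explicitMorphism m ι Qp (c.1.blocksFun i)))
  termination_by k => k
  decreasing_by exact blocksFun_lt c.1 c.2 i

/-- The maps `m̃_k : W^{⊗k} → W`,
`m̃_k = π ∑_{i ≥ 2} ∑_{b_1 + ⋯ + b_i = k} m_i (f̃_{b_1} ⊗ ⋯ ⊗ f̃_{b_i})`;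
for `k ≤ 1` the sum is empty, so that `m̃_0 = m̃_1 = 0`. -/
noncomputable def explicitMinimalModel (m : Ops K V V) (ι : W →ₗ[K] V) (π : V →ₗ[K] W)
    (Qp : V →ₗ[K] V) : Ops K W W := fun k =>
  π.compMultilinearMap (∑ c : {c : Composition k // 2 ≤ c.length},
    compAlong c.1 (m c.1.length) (fun i => explicitMorphism m ι Qp (c.1.blocksFun i)))

end AInfinity

/-! Write M(L) for the sum of m_i(f ⊗ ⋯ ⊗ f) over the partitions of a list L into at least two
blocks. Then f = ι − Q⁺M, where ι acts only on lists of length one, and m' = πM. Both halves of the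
lemma become identities between sums over deconcatenations and block partitions of lists; the signs
are absorbed in the parity involution τ.

`transfer` proves the A_∞-relations and the morphism relations by induction on the length. Summing
the relations of m over all partitions, and using the morphism relation on shorter lists, leaves
QM(L) + S = 0, where S is the sum of all insertions of m' into M. The insertions of m' into f then
add up to ιπM − Q⁺S = ιπM + Q⁺QM = M − QQ⁺M = M + Qf, which is the morphism relation. Those of m'
into itself add up to πS = −πQM = 0.

For cyclicity (`higherSum_cyclic`), take adjacent leaves x and y. Rotating m at the vertex where
their branches meet gives an identity of two sums (`splitSum_higherSum_cyclic`). After substituting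
f = ι − Q⁺M, the ι-terms are the two sides of the claim, and the Q⁺-terms agree because Q⁺ is
self-adjoint for ω up to sign (`form_Qp_left`). That symmetry follows from compatibility and the
cyclicity of m_1. The same inputs give ω(ιw, ιπx) = ω(ιw, x) (`form_ι_projection`), hence
nondegeneracy of the restricted form. Finally f_k has values in H^u for k ≥ 2, so each term of the
higher condition on f vanishes by itself. -/

namespace AInfinity

/-! ### Sums over deconcatenations and block partitions of a list. -/

section ListSums

variable {α β M N : Type*} [AddCommMonoid M] [AddCommMonoid N]

/-- The sum of `g A B` over all ways of writing a list as `A ++ B`. -/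
def splitSum : List α → (List α → List α → M) → M
  | [], g => g [] []
  | x :: L, g => g [] (x :: L) + splitSum L (fun A B => g (x :: A) B)

/-- The sum of `g ((x :: B) :: P)` if the argument is `B :: P`, and `0` for the empty list. -/
def consFirst (x : α) (g : List (List α) → M) : List (List α) → M
  | [] => 0
  | B :: P => g ((x :: B) :: P)

/-- The sum of `g P` over all ways `P` of cutting a list into nonempty blocks. -/
def partSum : List α → (List (List α) → M) → M
  | [], g => g []
  | x :: L, g => partSum L (fun P => g ([x] :: P) + consFirst x g P)

@[simp] theorem splitSum_nil (g : List α → List α → M) : splitSum [] g = g [] [] := rfl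

@[simp] theorem splitSum_cons (x : α) (L : List α) (g : List α → List α → M) :
    splitSum (x :: L) g = g [] (x :: L) + splitSum L (fun A B => g (x :: A) B) := rfl

@[simp] theorem partSum_nil (g : List (List α) → M) : partSum [] g = g [] := rfl

@[simp] theorem consFirst_nil (x : α) (g : List (List α) → M) : consFirst x g [] = 0 := rfl

@[simp] theorem consFirst_cons (x : α) (g : List (List α) → M) (B : List α) (P : List (List α)) :
    consFirst x g (B :: P) = g ((x :: B) :: P) := rfl

theorem partSum_cons (x : α) (L : List α) (g : List (List α) → M) :
    partSum (x :: L) g = partSum L (fun P => g ([x] :: P) + consFirst x g P) := rfl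

theorem splitSum_congr {L : List α} {g h : List α → List α → M}
    (H : ∀ A B, A ++ B = L → g A B = h A B) : splitSum L g = splitSum L h := by
  induction L generalizing g h with
  | nil => exact H [] [] rfl
  | cons x L ih =>
    rw [splitSum_cons, splitSum_cons, H [] _ rfl]
    congr 1
    exact ih fun A B hAB => H _ _ (by rw [List.cons_append, hAB])

theorem partSum_congr {L : List α} {g h : List (List α) → M}
    (H : ∀ P : List (List α), P.flatten = L → (∀ B ∈ P, B ≠ []) → g P = h P) :
    partSum L g = partSum L h := by
  induction L generalizing g h with
  | nil => exact H [] rfl (by simp)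
  | cons x L ih =>
    rw [partSum_cons, partSum_cons]
    refine ih fun P hP hne => ?_
    rw [H _ (by simp [hP]) (by simpa using hne)]
    congr 1
    cases P with
    | nil => rfl
    | cons B P =>
      refine H _ (by simpa using hP) ?_
      simp only [List.mem_cons, forall_eq_or_imp] at hne ⊢
      exact ⟨by simp, hne.2⟩

theorem splitSum_zero (L : List α) : splitSum L (fun _ _ => (0 : M)) = 0 := by
  induction L with
  | nil => rfl
  | cons x L ih => simp [ih]

theorem consFirst_zero (x : α) (P : List (List α)) : consFirst x (fun _ => (0 : M)) P = 0 := by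
  cases P <;> rfl

theorem partSum_zero (L : List α) : partSum L (fun _ => (0 : M)) = 0 := by
  induction L with
  | nil => rfl
  | cons x L ih => simp [partSum_cons, consFirst_zero, ih]

theorem splitSum_add (L : List α) (g h : List α → List α → M) :
    splitSum L (fun A B => g A B + h A B) = splitSum L g + splitSum L h := by
  induction L generalizing g h with
  | nil => rfl
  | cons x L ih => simp only [splitSum_cons, ih]; abel

theorem consFirst_add (x : α) (g h : List (List α) → M) (P : List (List α)) :
    consFirst x (fun P => g P + h P) P = consFirst x g P + consFirst x h P := by
  cases P <;> simp

theorem partSum_add (L : List α) (g h : List (List α) → M) :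
    partSum L (fun P => g P + h P) = partSum L g + partSum L h := by
  induction L generalizing g h with
  | nil => rfl
  | cons x L ih =>
    simp only [partSum_cons, consFirst_add]
    rw [← ih]
    congr 1
    funext P
    abel

theorem map_splitSum {F : Type*} [FunLike F M N] [AddMonoidHomClass F M N] (φ : F) (L : List α)
    (g : List α → List α → M) : φ (splitSum L g) = splitSum L (fun A B => φ (g A B)) := by
  induction L generalizing g with
  | nil => rfl
  | cons x L ih => simp only [splitSum_cons, map_add, ih]

theorem map_partSum {F : Type*} [FunLike F M N] [AddMonoidHomClass F M N] (φ : F) (L : List α)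
    (g : List (List α) → M) : φ (partSum L g) = partSum L (fun P => φ (g P)) := by
  induction L generalizing g with
  | nil => rfl
  | cons x L ih =>
    simp only [partSum_cons, ih, map_add]
    congr 1
    funext P
    cases P <;> simp

theorem splitSum_comm (L : List α) (L' : List β) (g : List α → List α → List β → List β → M) :
    splitSum L (fun A B => splitSum L' (fun C D => g A B C D)) =
      splitSum L' (fun C D => splitSum L (fun A B => g A B C D)) := by
  induction L generalizing g with
  | nil => rfl
  | cons x L ih => simp only [splitSum_cons, splitSum_add, ih]

theorem partSum_splitSum_comm (L : List α) (L' : List β)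
    (g : List (List α) → List β → List β → M) :
    partSum L (fun P => splitSum L' (fun C D => g P C D)) =
      splitSum L' (fun C D => partSum L (fun P => g P C D)) := by
  induction L' generalizing g with
  | nil => rfl
  | cons x L' ih => simp only [splitSum_cons, partSum_add, ih]

theorem partSum_comm (L : List α) (L' : List β) (g : List (List α) → List (List β) → M) :
    partSum L (fun P => partSum L' (fun R => g P R)) =
      partSum L' (fun R => partSum L (fun P => g P R)) := by
  induction L generalizing g with
  | nil => rfl
  | cons x L ih =>
    simp only [partSum_cons, partSum_add, ih]
    congr 1
    rw [← ih]
    congr 1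
    funext P
    cases P with
    | nil => simp [partSum_zero]
    | cons B P => rfl

theorem splitSum_map (φ : β → α) (L : List β) (g : List α → List α → M) :
    splitSum (L.map φ) g = splitSum L (fun A B => g (A.map φ) (B.map φ)) := by
  induction L generalizing g with
  | nil => rfl
  | cons x L ih => simp [ih]

theorem partSum_map (φ : β → α) (L : List β) (g : List (List α) → M) :
    partSum (L.map φ) g = partSum L (fun P => g (P.map (List.map φ))) := by
  induction L generalizing g with
  | nil => rfl
  | cons x L ih =>
    simp only [List.map_cons, partSum_cons, ih]
    congr 1
    funext P
    cases P <;> simp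

/-- Coassociativity of deconcatenation. -/
theorem splitSum_assoc (L : List α) (g : List α → List α → List α → M) :
    splitSum L (fun A B => splitSum A (fun A₁ A₂ => g A₁ A₂ B)) =
      splitSum L (fun A B => splitSum B (fun B₁ B₂ => g A B₁ B₂)) := by
  induction L generalizing g with
  | nil => rfl
  | cons x L ih =>
    simp only [splitSum_cons, splitSum_nil, splitSum_add, ih, add_assoc]

/-- Two ways of cutting a list into five pieces. -/
theorem splitSum_five (L : List α) (g : List α → List α → List α → List α → List α → M) :
    splitSum L (fun A R => splitSum R (fun X E => splitSum X (fun B R' => splitSum R'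
      (fun C D => g A B C D E)))) =
    splitSum L (fun X R => splitSum R (fun C Y => splitSum X (fun A B => splitSum Y
      (fun D E => g A B C D E)))) := by
  -- Coassociativity brings the left side to the fully right-nested form and then groups A with B;
  -- the splittings of X and R are independent and can be exchanged.
  calc _ = splitSum L (fun A R => splitSum R (fun B Y => splitSum Y (fun C Z => splitSum Z
          (fun D E => g A B C D E)))) := by
        refine splitSum_congr fun A R _ => ?_
        rw [splitSum_assoc R (fun B R' E => splitSum R' (fun C D => g A B C D E))]
        refine splitSum_congr fun B Y _ => ?_
        exact splitSum_assoc Y (fun C D E => g A B C D E)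
    _ = splitSum L (fun X R => splitSum X (fun A B => splitSum R (fun C Z => splitSum Z
          (fun D E => g A B C D E)))) :=
        (splitSum_assoc L (fun A B Y => splitSum Y (fun C Z => splitSum Z
          (fun D E => g A B C D E)))).symm
    _ = _ := splitSum_congr fun X R _ => splitSum_comm X R _

theorem splitSum_eq_left {L : List α} {g : List α → List α → M}
    (H : ∀ A B, A ++ B = L → B ≠ [] → g A B = 0) : splitSum L g = g L [] := by
  induction L generalizing g with
  | nil => rfl
  | cons x L ih =>
    rw [splitSum_cons, H [] _ rfl (by simp), zero_add]
    exact ih fun A B hAB hB => H _ _ (by rw [List.cons_append, hAB]) hB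

theorem splitSum_eq_right {L : List α} {g : List α → List α → M}
    (H : ∀ A B, A ++ B = L → A ≠ [] → g A B = 0) : splitSum L g = g [] L := by
  cases L with
  | nil => rfl
  | cons x L =>
    rw [splitSum_cons, splitSum_congr (h := fun _ _ => 0), splitSum_zero, add_zero]
    exact fun A B hAB => H _ _ (by rw [List.cons_append, hAB]) (by simp)

/-- A partition has no block only if the list is empty. -/
theorem partSum_ite_nil (L : List α) (c : M) :
    partSum L (fun P => if P = [] then c else 0) = if L = [] then c else 0 := by
  by_cases h : L = []
  · subst h; rfl
  · rw [if_neg h]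
    refine (partSum_congr fun P hP _ => if_neg ?_).trans (partSum_zero L)
    rintro rfl
    exact h hP.symm

/-- Summation over the first block. -/
theorem partSum_cons_eq (x : α) (L : List α) (g : List (List α) → M) :
    partSum (x :: L) g = splitSum L (fun A B => partSum B (fun P => g ((x :: A) :: P))) := by
  induction L generalizing x g with
  | nil => simp [partSum_cons]
  | cons y L ih =>
    rw [partSum_cons, partSum_add, splitSum_cons, ih y (consFirst x g)]
    rfl

/-- Summation over the block that contains a given entry. -/
theorem partSum_append_cons (A : List α) (y : α) (D : List α) (g : List (List α) → M) :
    partSum (A ++ y :: D) g = splitSum A (fun A₁ A₂ => partSum A₁ (fun P₁ =>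
      splitSum D (fun D₁ D₂ => partSum D₂ (fun P₂ => g (P₁ ++ (A₂ ++ y :: D₁) :: P₂))))) := by
  induction A generalizing g with
  | nil => simp [partSum_cons_eq]
  | cons a A ih =>
    rw [List.cons_append, partSum_cons, ih, splitSum_cons]
    simp only [partSum_cons, splitSum_add, partSum_add, partSum_nil, List.nil_append,
      List.cons_append]
    rw [add_left_comm]
    congr 1
    -- When no block precedes the one containing y, the entry a joins that very block. This term is
    -- rewritten as a sum supported at P₁ = [], so that the two sides can be compared termwise.
    have key : splitSum D (fun D₁ D₂ => partSum D₂ (fun P₂ => g ((a :: (A ++ y :: D₁)) :: P₂))) =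
        splitSum A (fun A₁ A₂ => partSum A₁ (fun P₁ => if P₁ = [] then
          splitSum D (fun D₁ D₂ => partSum D₂ (fun P₂ => g ((a :: (A₂ ++ y :: D₁)) :: P₂)))
          else 0)) := by
      simp only [partSum_ite_nil]
      rw [splitSum_eq_right fun A₁ A₂ _ h => if_neg h, if_pos rfl]
    rw [key, ← splitSum_add]
    refine splitSum_congr fun A₁ A₂ _ => ?_
    rw [← partSum_add]
    refine partSum_congr fun P₁ _ _ => ?_
    cases P₁ <;> simp

/-- Summation over the last block. -/
theorem partSum_concat (L : List α) (x : α) (g : List (List α) → M) :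
    partSum (L ++ [x]) g =
      splitSum L (fun A B => partSum A (fun P => g (P ++ [B ++ [x]]))) := by
  simp [partSum_append_cons]

/-- Splitting a partition amounts to splitting the list and partitioning both parts. -/
theorem partSum_splitSum (L : List α) (g : List (List α) → List (List α) → M) :
    partSum L (fun P => splitSum P g) =
      splitSum L (fun A B => partSum A (fun P => partSum B (fun R => g P R))) := by
  induction L generalizing g with
  | nil => rfl
  | cons x L ih =>
    have h1 : ∀ P : List (List α), consFirst x (fun P => splitSum P g) P =
        consFirst x (g []) P + splitSum P (fun A B => consFirst x (fun A => g A B) A) := by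
      intro P
      cases P <;> simp
    have h2 : ∀ (B : List α) (P : List (List α)),
        consFirst x (fun P => partSum B (fun R => g P R)) P =
          partSum B (fun R => consFirst x (fun A => g A R) P) := by
      intro B P
      cases P <;> simp [partSum_zero]
    simp only [partSum_cons, splitSum_cons, partSum_nil, h1, h2, partSum_add, splitSum_add, ih]
    abel

/-- The part of a sum over partitions that comes from a single block. -/
theorem partSum_single (x : α) (L : List α) (h : List α → M) :
    partSum (x :: L) (fun P => if P.length < 2 then h P.flatten else 0) = h (x :: L) := by
  rw [partSum_cons_eq, splitSum_congr (h := fun A B => if B = [] then h (x :: A) else 0),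
    splitSum_eq_left fun A B _ hB => if_neg hB, if_pos rfl]
  intro A B _
  rw [← partSum_ite_nil]
  refine partSum_congr fun P _ _ => ?_
  cases P <;> simp

theorem partSum_mem {S : Type*} [SetLike S M] [AddSubmonoidClass S M] (s : S) {L : List α}
    {g : List (List α) → M}
    (H : ∀ P : List (List α), P.flatten = L → (∀ B ∈ P, B ≠ []) → g P ∈ s) :
    partSum L g ∈ s := by
  induction L generalizing g with
  | nil => exact H [] rfl (by simp)
  | cons x L ih =>
    refine ih fun P hP hne => add_mem (H _ (by simp [hP]) (by simpa using hne)) ?_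
    cases P with
    | nil => exact zero_mem s
    | cons B P =>
      refine H _ (by simpa using hP) ?_
      simp only [List.mem_cons, forall_eq_or_imp] at hne ⊢
      exact ⟨by simp, hne.2⟩

/-- Blocks of a partition into at least two blocks are shorter than the list. -/
theorem length_lt_of_mem_partition {P : List (List α)} (h2 : 2 ≤ P.length)
    (hne : ∀ B ∈ P, B ≠ []) {B : List α} (hB : B ∈ P) : B.length < P.flatten.length := by
  obtain ⟨P₁, P₂, rfl⟩ := List.append_of_mem hB
  have h : ∃ C ∈ P₁ ++ P₂, C ≠ [] := by
    cases P₁ with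
    | cons C _ => exact ⟨C, by simp, hne _ (by simp)⟩
    | nil =>
      cases P₂ with
      | cons C _ => exact ⟨C, by simp, hne _ (by simp)⟩
      | nil => simp at h2
  obtain ⟨C, hC, hC0⟩ := h
  have hpos := List.length_pos_iff.mpr hC0
  rw [List.mem_append] at hC
  simp only [List.flatten_append, List.flatten_cons, List.length_append]
  rcases hC with hC | hC <;>
  · have := (List.sublist_flatten_of_mem hC).length_le
    omega

end ListSums

/-! ### Compositions of an integer as partitions of a list. -/

section Compositions

variable {α M : Type*} [AddCommMonoid M]

theorem splitSum_eq_sum_range (L : List α) (g : List α → List α → M) :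
    splitSum L g = ∑ j ∈ Finset.range (L.length + 1), g (L.take j) (L.drop j) := by
  induction L generalizing g with
  | nil => simp
  | cons x L ih =>
    rw [splitSum_cons, ih, List.length_cons, Finset.sum_range_succ' _ (L.length + 1), add_comm]
    rfl

/-- This says that the recursion defining `partSum` visits each partition into nonempty blocks
exactly once: the first block of P₀ decides whether the head stands alone or joins the next block.
-/
theorem partSum_ite_eq [DecidableEq α] (P₀ : List (List α)) (hne : ∀ B ∈ P₀, B ≠ []) (c : M) :
    partSum P₀.flatten (fun P => if P = P₀ then c else 0) = c := by
  suffices H : ∀ (L : List α) (P₀ : List (List α)), P₀.flatten = L → (∀ B ∈ P₀, B ≠ []) →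
      partSum L (fun P => if P = P₀ then c else 0) = c from H _ _ rfl hne
  intro L
  induction L with
  | nil =>
    intro P₀ hP hne
    cases P₀ with
    | nil => simp
    | cons B P => simp_all
  | cons x L ih =>
    intro P₀ hP hne
    match P₀, hP, hne with
    | [] :: P, _, hne => simp at hne
    | [y] :: P, hP, hne =>
      obtain ⟨rfl, hP'⟩ : y = x ∧ P.flatten = L := by simpa using hP
      rw [partSum_cons]
      refine Eq.trans (partSum_congr fun R _ hR => ?_) (ih P hP' fun B hB => hne B (by simp [hB]))
      cases R with
      | nil => simp
      | cons B R =>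
        have : B ≠ [] := hR B (by simp)
        simp [this]
    | (y :: z :: B) :: P, hP, hne =>
      obtain ⟨rfl, hP'⟩ : y = x ∧ ((z :: B) :: P).flatten = L := by simpa using hP
      rw [partSum_cons]
      refine Eq.trans (partSum_congr fun R _ hR => ?_) (ih ((z :: B) :: P) hP' ?_)
      · cases R <;> simp
      · simp only [List.mem_cons, forall_eq_or_imp] at hne ⊢
        exact ⟨by simp, hne.2⟩

theorem finset_sum_partSum {ι : Type*} (s : Finset ι) (L : List α) (g : ι → List (List α) → M) :
    ∑ i ∈ s, partSum L (g i) = partSum L (fun P => ∑ i ∈ s, g i P) := by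
  classical
  induction s using Finset.induction_on with
  | empty => simp [partSum_zero]
  | insert i s hi ih => simp [Finset.sum_insert hi, ih, partSum_add]

/-- Sums over compositions as sums over partitions of a list. -/
theorem sum_composition (L : List α) (g : List (List α) → M) :
    ∑ c : Composition L.length, g (L.splitWrtComposition c) = partSum L g := by
  classical
  have h1 : ∀ c : Composition L.length, g (L.splitWrtComposition c) = partSum L (fun P =>
      if P = L.splitWrtComposition c then g (L.splitWrtComposition c) else 0) := by
    intro c
    have := partSum_ite_eq (L.splitWrtComposition c) (fun B hB =>
      List.length_pos_iff.mp (List.length_pos_of_mem_splitWrtComposition hB))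
      (g (L.splitWrtComposition c))
    rw [List.flatten_splitWrtComposition] at this
    exact this.symm
  -- After exchanging the sums, only the composition formed by the block lengths of P survives for a
  -- fixed partition P.
  rw [Finset.sum_congr rfl fun c _ => h1 c, finset_sum_partSum]
  refine partSum_congr ?_
  rintro P rfl hne
  have hpos : ∀ {i : ℕ}, i ∈ P.map List.length → 0 < i := by
    intro i hi
    obtain ⟨B, hB, rfl⟩ := List.mem_map.mp hi
    exact List.length_pos_iff.mpr (hne B hB)
  let c₀ : Composition P.flatten.length := ⟨P.map List.length, hpos, by simp [List.length_flatten]⟩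
  have hc₀ : P.flatten.splitWrtComposition c₀ = P := List.splitWrtComposition_flatten P c₀ rfl
  rw [Finset.sum_eq_single c₀]
  · rw [hc₀, if_pos rfl]
  · intro c _ hc
    refine if_neg fun h => hc ?_
    have := List.map_length_splitWrtComposition P.flatten c
    rw [← h] at this
    exact Composition.ext this.symm
  · simp

end Compositions

/-! ### Evaluation of operations on lists, and signs as an involution. -/

section Evaluation

variable {K : Type*} [Field K]
variable {U V W : Type*} [AddCommGroup U] [Module K U] [AddCommGroup V] [Module K V]
  [AddCommGroup W] [Module K W]

/-- The value of the multilinear map with the appropriate number of arguments on a list. -/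
def Ops.eval (f : Ops K V W) (L : List V) : W := f L.length L.get

/-- Comparing entries by their natural-number index avoids casts between `Fin` types of
propositionally equal size. -/
theorem Ops.eval_eq (f : Ops K V W) {L : List V} {k : ℕ} (h : L.length = k) (v : Fin k → V)
    (hv : ∀ (i : ℕ) (hi : i < L.length), L[i] = v ⟨i, h ▸ hi⟩) : f.eval L = f k v := by
  subst h
  exact congrArg _ (funext fun i : Fin _ => hv i i.2)

theorem Ops.eval_ofFn (f : Ops K V W) {k : ℕ} (v : Fin k → V) : f.eval (List.ofFn v) = f k v :=
  f.eval_eq (List.length_ofFn) v (by simp)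

theorem Ops.eval_singleton (f : Ops K V W) (x : V) : f.eval [x] = f.lin x :=
  f.eval_eq rfl (fun _ => x) (by simp)

/-- Evaluation as a linear map of one entry of the list. -/
def Ops.evalAt (f : Ops K V W) (X Y : List V) : V →ₗ[K] W :=
  (f (X.length + (Y.length + 1))).toLinearMap
    (fun i => (X ++ 0 :: Y)[(i : ℕ)]'(by simp)) ⟨X.length, by omega⟩

theorem Ops.evalAt_apply (f : Ops K V W) (X Y : List V) (a : V) :
    f.evalAt X Y a = f.eval (X ++ a :: Y) := by
  symm
  refine f.eval_eq (by simp) _ fun i hi => ?_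
  by_cases h : i = X.length
  · subst h
    simp
  · rw [Function.update_of_ne (by simpa [Fin.ext_iff] using h)]
    rcases lt_or_gt_of_ne h with h | h
    · rw [List.getElem_append_left h, List.getElem_append_left h]
    · rw [List.getElem_append_right h.le, List.getElem_append_right h.le]
      obtain ⟨r, hr⟩ : ∃ r, i - X.length = r + 1 := ⟨i - X.length - 1, by omega⟩
      simp [hr]

theorem Ops.eval_zero_entry (f : Ops K V W) (X Y : List V) : f.eval (X ++ 0 :: Y) = 0 := by
  rw [← Ops.evalAt_apply, map_zero]

theorem compAlong_apply {L : List V} (c : Composition L.length) (g : Ops K W U) (f : Ops K V W) :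
    compAlong c (g c.length) (fun i => f (c.blocksFun i)) L.get =
      g.eval ((L.splitWrtComposition c).map f.eval) := by
  symm
  refine g.eval_eq (by simp) _ fun i hi => ?_
  have hi' : i < c.length := by simpa using hi
  rw [List.getElem_map]
  have hlen : ((L.splitWrtComposition c)[i]'(by simpa using hi')).length =
      c.blocksFun ⟨i, hi'⟩ := by
    have := List.getElem_map List.length (l := L.splitWrtComposition c) (i := i)
      (h := by simpa using hi')
    rw [← this]
    simp only [List.map_length_splitWrtComposition]
    rfl
  refine f.eval_eq hlen _ fun s hs => ?_
  simp [List.getElem_splitWrtComposition]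

/-- The predicate serves two uses: always true for the morphism relation, and `2 ≤ k` for the
recursive definitions. -/
theorem sum_compAlong {n : ℕ} (g : Ops K W U) (f : Ops K V W) (p : ℕ → Prop) [DecidablePred p]
    (v : Fin n → V) {L : List V} (h : L.length = n)
    (hv : ∀ (i : ℕ) (hi : i < L.length), L[i] = v ⟨i, h ▸ hi⟩) :
    (∑ c : Composition n, if p c.length then
      compAlong c (g c.length) (fun i => f (c.blocksFun i)) v else 0) =
      partSum L (fun P => if p P.length then g.eval (P.map f.eval) else 0) := by
  subst h
  obtain rfl : v = L.get := funext fun i => (hv i i.2).symm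
  rw [← sum_composition]
  refine Finset.sum_congr rfl fun c _ => ?_
  rw [compAlong_apply, List.length_splitWrtComposition]

/-- The sum of all insertions of an operation `m` into the operations `f`, with the signs given
by an involution `τ`. -/
def insertion (τ : V → V) (f : Ops K V W) (m : Ops K V V) (L : List V) : W :=
  splitSum L (fun A R => splitSum R (fun B D => f.eval (A.map τ ++ m.eval B :: D)))

theorem prod_ite_zpow (d : ℕ → ℤ) (j k : ℕ) (h : j ≤ k) :
    (∏ i : Fin k, if (i : ℕ) < j then (-1 : K) ^ d i else 1) =
      (-1 : K) ^ (∑ i ∈ Finset.range j, d i) := by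
  rw [Fin.prod_univ_eq_prod_range (fun i => if i < j then (-1 : K) ^ d i else 1) k,
    ← Finset.prod_subset (Finset.range_mono h) fun x _ hx =>
      if_neg (by simpa using hx)]
  rw [Finset.prod_congr rfl fun i hi => if_pos (Finset.mem_range.mp hi)]
  clear h
  induction j with
  | zero => simp
  | succ j ih =>
    rw [Finset.prod_range_succ, Finset.sum_range_succ, zpow_add₀ (by simp), ih]

/-- By multilinearity, the sign in front of an insertion is the effect of applying τ to every entry
to its left. Explicit signs thus drop out of the combinatorics. -/
theorem insertSum_eq_insertion {𝒜 : ℤ → Submodule K V} {τ : V →ₗ[K] V}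
    (hτ : ∀ (d : ℤ) (x : V), x ∈ 𝒜 d → τ x = (-1 : K) ^ d • x) (f : Ops K V W) (m : Ops K V V)
    (hm0 : m 0 = 0) (n : ℕ) (d : ℕ → ℤ) (o : ℕ → V) (ho : ∀ i, o i ∈ 𝒜 (d i)) :
    insertSum f m n d o = insertion τ f m (List.ofFn (fun i : Fin n => o i)) := by
  set L := List.ofFn (fun i : Fin n => o i) with hL
  have hlen : L.length = n := by simp [hL]
  have hget : ∀ (i : ℕ) (hi : i < L.length), L[i] = o i := by simp [hL]
  have term : ∀ j l : ℕ, 1 ≤ l → j + l ≤ n →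
      f.eval ((L.take j).map τ ++ m.eval ((L.drop j).take l) :: (L.drop j).drop l) =
      (-1 : K) ^ (∑ i ∈ Finset.range j, d i) •
      f (n - l + 1) (fun i => splice o j l (m l (fun s => o (j + s))) i) := by
    intro j l hl hjl
    have h1 : m.eval ((L.drop j).take l) = m l (fun s => o (j + s)) :=
      m.eval_eq (by simp [hlen]; omega) _ (by simp [hget])
    -- The sign is spread over all slots, with factor 1 from position j on, so that it can be moved
    -- into the arguments.
    rw [← prod_ite_zpow d j (n - l + 1) (by omega), ← MultilinearMap.map_smul_univ, h1]
    refine f.eval_eq (by simp [hlen]; omega) _ fun i hi => ?_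
    have hj : ((L.take j).map τ).length = j := by simp [hlen]; omega
    rcases lt_trichotomy i j with h | h | h
    · rw [List.getElem_append_left (by omega)]
      simp [splice, h, hget, hτ _ _ (ho i)]
    · subst h
      rw [List.getElem_append_right (by omega)]
      have e1 : i - min i n = 0 := by omega
      simp [hlen, e1, splice]
    · rw [List.getElem_append_right (by omega)]
      obtain ⟨r, rfl⟩ : ∃ r, i = j + r + 1 := ⟨i - j - 1, by omega⟩
      have e1 : j + r + 1 - min j n = r + 1 := by omega
      have e2 : j + r + l = j + l + r := by omega
      have e3 : ¬ (j + r + 1 < j) := by omega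
      have e4 : j + r + 1 ≠ j := by omega
      simp [hlen, e1, splice, hget, e2, e3, e4]
  have hins : insertion τ f m L = ∑ j ∈ Finset.range (n + 1), ∑ l ∈ Finset.Icc 1 (n - j),
      f.eval ((L.take j).map τ ++ m.eval ((L.drop j).take l) :: (L.drop j).drop l) := by
    simp only [insertion, splitSum_eq_sum_range, hlen]
    refine Finset.sum_congr rfl fun j _ => ?_
    symm
    rw [List.length_drop, hlen]
    -- `insertion` also allows l = 0; those terms insert m_0 = 0.
    refine Finset.sum_subset (fun l hl => ?_) fun l hl hl' => ?_
    · simp only [Finset.mem_Icc, Finset.mem_range] at hl ⊢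
      omega
    · obtain rfl : l = 0 := by
        simp only [Finset.mem_Icc, Finset.mem_range] at hl hl'
        omega
      have : m.eval ([] : List V) = 0 := by
        simp only [Ops.eval, List.length_nil]
        rw [hm0]
        rfl
      rw [List.take_zero, this, Ops.eval_zero_entry]
  rw [hins, insertSum, Finset.sum_comm' (t' := Finset.range (n + 1))
    (s' := fun j => Finset.Icc 1 (n - j))]
  · refine Finset.sum_congr rfl fun j hj => Finset.sum_congr rfl fun l hl => (term j l ?_ ?_).symm
    all_goals
      simp only [Finset.mem_Icc, Finset.mem_range] at hj hl
      omega
  · intro l j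
    simp only [Finset.mem_Icc, Finset.mem_range]
    omega

end Evaluation

/-! ### Homotopy transfer of the A_∞-relations. -/

section Transfer

variable {K : Type*} [Field K]
variable {V W : Type*} [AddCommGroup V] [Module K V] [AddCommGroup W] [Module K W]

/-- The sum of `m_i (f ⊗ ⋯ ⊗ f)` over all partitions of the arguments. -/
def fullSum (m : Ops K V V) (f : Ops K W V) (L : List W) : V :=
  partSum L (fun P => m.eval (P.map f.eval))

/-- The sum of `m_i (f ⊗ ⋯ ⊗ f)` over all partitions of the arguments into `i ≥ 2` blocks. -/
def higherSum (m : Ops K V V) (f : Ops K W V) (L : List W) : V :=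
  partSum L (fun P => if 2 ≤ P.length then m.eval (P.map f.eval) else 0)

theorem fullSum_eq {m : Ops K V V} {f : Ops K W V} (hm : m.eval [] = 0) (hf : f.eval [] = 0)
    (L : List W) : fullSum m f L = higherSum m f L + m.lin (f.eval L) := by
  cases L with
  | nil => simp [fullSum, higherSum, hm, hf]
  | cons x L =>
    rw [← Ops.eval_singleton, ← partSum_single x L (fun B => m.eval [f.eval B]), higherSum,
      ← partSum_add]
    refine partSum_congr fun P hP _ => ?_
    match P, hP with
    | [], hP => simp at hP
    | [B], _ => simp
    | B :: C :: P, _ => simp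

/-- The operation `m` applied to `f`-values of the blocks around the sublist `B`, with entry
`v B` at the place of `B`. -/
def blockInsertion (τ : V → V) (m : Ops K V V) (f : Ops K W V) (v : List W → V) (L : List W) : V :=
  splitSum L (fun A R => splitSum R (fun B D => partSum A (fun P => partSum D (fun P' =>
    m.evalAt ((P.map f.eval).map τ) (P'.map f.eval) (v B)))))

theorem blockInsertion_add (τ : V → V) (m : Ops K V V) (f : Ops K W V) (v w : List W → V)
    (L : List W) : blockInsertion τ m f (fun B => v B + w B) L =
      blockInsertion τ m f v L + blockInsertion τ m f w L := by
  simp only [blockInsertion, map_add, partSum_add, splitSum_add]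

/-- The middle piece has full length only if both outer pieces are empty. -/
theorem splitSum_splitSum_eq {α M : Type*} [AddCommMonoid M] {L : List α}
    {g : List α → List α → List α → M}
    (H : ∀ A B D, A ++ (B ++ D) = L → B.length < L.length → g A B D = 0) :
    splitSum L (fun A R => splitSum R (fun B D => g A B D)) = g [] L [] := by
  rw [splitSum_eq_right, splitSum_eq_left]
  · intro B D h hD
    refine H [] B D (by simpa using h) ?_
    have := List.length_pos_iff.mpr hD
    rw [← h, List.length_append]
    omega
  · intro A R h hA
    rw [← splitSum_zero R]
    refine splitSum_congr fun B D h' => H A B D (by rw [h', h]) ?_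
    have := List.length_pos_iff.mpr hA
    rw [← h, ← h', List.length_append, List.length_append]
    omega

/-- Meant for the defect of the morphism relation, which by induction vanishes on shorter lists, so
that only m_1 of its value on L remains. -/
theorem blockInsertion_eq (τ : V → V) (m : Ops K V V) (f : Ops K W V) {v : List W → V}
    {L : List W} (hv : ∀ A B D, A ++ (B ++ D) = L → B.length < L.length → v B = 0) :
    blockInsertion τ m f v L = m.lin (v L) := by
  rw [blockInsertion, splitSum_splitSum_eq]
  · simp [Ops.evalAt_apply, Ops.eval_singleton]
  · intro A B D h hB
    simp [hv A B D h hB, partSum_zero]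

/-- Summing the `A_∞`-relations of `m` on the blocks of all partitions. -/
theorem partSum_insertion (τ : V → V) (m : Ops K V V) (f : Ops K W V) (L : List W) :
    partSum L (fun P => insertion τ m m (P.map f.eval)) =
      blockInsertion τ m f (fullSum m f) L := by
  simp only [insertion, splitSum_map, blockInsertion, fullSum, map_partSum, Ops.evalAt_apply]
  rw [partSum_splitSum]
  refine splitSum_congr fun A R _ => ?_
  rw [← partSum_splitSum_comm]
  refine partSum_congr fun P _ _ => ?_
  rw [partSum_splitSum]
  exact splitSum_congr fun B D _ => partSum_comm _ _ _ |>.trans rfl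

/-- In a partition of A ++ m'(B) :: D, exactly one block contains the new entry, and that block is
an insertion of m' into f. `hτ` carries the signs of the earlier blocks through f, and
`splitSum_five` matches the two ways of cutting L. -/
theorem blockInsertion_insertion {τ : V → V} {τ' : W → W} {f : Ops K W V} {L : List W}
    (hτ : ∀ B, B ⊆ L → f.eval (B.map τ') = τ (f.eval B)) (m : Ops K V V) (m' : Ops K W W) :
    blockInsertion τ m f (insertion τ' f m') L =
      splitSum L (fun A R => splitSum R (fun B D => fullSum m f (A.map τ' ++ m'.eval B :: D))) := by
  have h1 : ∀ A B D : List W, A ⊆ L → fullSum m f (A.map τ' ++ m'.eval B :: D) =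
      splitSum A (fun A₁ A₂ => splitSum D (fun D₁ D₂ => partSum A₁ (fun P => partSum D₂ (fun P' =>
        m.evalAt ((P.map f.eval).map τ) (P'.map f.eval)
          (f.eval (A₂.map τ' ++ m'.eval B :: D₁)))))) := by
    intro A B D hA
    rw [fullSum, partSum_append_cons, splitSum_map]
    refine splitSum_congr fun A₁ A₂ hA' => ?_
    rw [partSum_map, ← partSum_splitSum_comm]
    refine partSum_congr fun P hP _ => ?_
    refine splitSum_congr fun D₁ D₂ _ => partSum_congr fun P' _ _ => ?_
    rw [Ops.evalAt_apply, List.map_append, List.map_cons, List.map_map, List.map_map]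
    congr 2
    refine List.map_congr_left fun B hB => hτ B fun x hx => hA ?_
    rw [← hA', ← hP]
    exact List.mem_append_left _ (List.mem_flatten.mpr ⟨B, hB, hx⟩)
  refine Eq.trans ?_ (splitSum_congr fun A R hAR => splitSum_congr fun B D _ =>
    (h1 A B D (by rw [← hAR]; exact List.subset_append_left A R)).symm)
  rw [← splitSum_five]
  simp only [blockInsertion, insertion, map_splitSum]
  refine splitSum_congr fun A R _ => splitSum_congr fun X E _ => ?_
  simp only [partSum_splitSum_comm]

/-- Homotopy transfer: if `f_1 = ι`, `f_k = -Q⁺ ∑ m (f ⊗ ⋯ ⊗ f)` and `m' = π ∑ m (f ⊗ ⋯ ⊗ f)`, then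
`f` satisfies the morphism relations and `m'` the `A_∞`-relations. -/
theorem transfer {τ : V → V} {τ' : W → W} {m : Ops K V V} {f : Ops K W V} {m' : Ops K W W}
    {ι : W →ₗ[K] V} {π : V →ₗ[K] W} {Qp : V →ₗ[K] V} (p : W → Prop) (q : V → Prop)
    (hm0 : m.eval [] = 0) (hf0 : f.eval [] = 0) (hf1 : ∀ x, f.eval [x] = ι x)
    (hf2 : ∀ L : List W, 2 ≤ L.length → f.eval L = -Qp (higherSum m f L))
    (hm' : ∀ L, m'.eval L = π (higherSum m f L))
    (hτ : ∀ L : List W, (∀ x ∈ L, p x) → f.eval (L.map τ') = τ (f.eval L))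
    (hq : ∀ L : List W, (∀ x ∈ L, p x) → q (f.eval L))
    (hA : ∀ L : List V, (∀ x ∈ L, q x) → insertion τ m m L = 0)
    (hQι : m.lin ∘ₗ ι = 0) (hπQ : π ∘ₗ m.lin = 0)
    (hHK : m.lin ∘ₗ Qp + Qp ∘ₗ m.lin + ι ∘ₗ π = LinearMap.id)
    (L : List W) (hL : ∀ x ∈ L, p x) :
    fullSum m f L = insertion τ' f m' L ∧ insertion τ' m' m' L = 0 := by
  have hshort : ∀ X : List W, X.length < 2 → higherSum m f X = 0 := by
    intro X hX
    match X, hX with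
    | [], _ => simp [higherSum]
    | [x], _ => simp [higherSum, partSum_cons]
  -- `X.sum` names the only entry of a one-element list, which gives one formula for all lengths.
  have hfX : ∀ X : List W, f.eval X = (if X.length = 1 then ι X.sum else 0) -
      Qp (higherSum m f X) := by
    intro X
    match X with
    | [] => simp [hf0, hshort]
    | [x] => simp [hf1, hshort]
    | x :: y :: X => rw [hf2 _ (by simp)]; simp
  have hQQ : ∀ x : V, q x → m.lin (m.lin x) = 0 := by
    intro x hx
    have := hA [x] (by simpa using hx)
    -- The terms of the one-argument relation with empty middle piece insert m_0 = 0; what remains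
    -- is Q² = 0.
    have h0 : m.eval [0, x] = 0 := m.eval_zero_entry [] [x]
    have h0' : m.eval [τ x, 0] = 0 := m.eval_zero_entry [τ x] []
    simpa [insertion, hm0, h0, h0', Ops.eval_zero_entry, Ops.eval_singleton] using this
  suffices key : ∀ L : List W, (∀ x ∈ L, p x) →
      (∀ B : List W, (∀ x ∈ B, p x) → B.length < L.length →
        fullSum m f B = insertion τ' f m' B) →
      fullSum m f L = insertion τ' f m' L ∧ insertion τ' m' m' L = 0 by
    refine key L hL fun B hB _ => ?_
    generalize hn : B.length = n
    induction n using Nat.strong_induction_on generalizing B with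
    | _ n ih =>
      exact (key B hB fun C hC hlt => ih _ (hn ▸ hlt) C hC (by omega) rfl).1
  clear hL L
  intro L hL ih
  set S : V := splitSum L (fun A R => splitSum R (fun B D =>
    higherSum m f (A.map τ' ++ m'.eval B :: D))) with hS
  have hQM : m.lin (higherSum m f L) + S = 0 := by
    have h0 : blockInsertion τ m f (fullSum m f) L = 0 := by
      rw [← partSum_insertion, ← partSum_zero L]
      refine partSum_congr fun P hP _ => hA _ ?_
      intro x hx
      obtain ⟨B, hB, rfl⟩ := List.mem_map.mp hx
      exact hq B fun y hy => hL y (hP ▸ List.mem_flatten.mpr ⟨B, hB, hy⟩)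
    -- The full sum is split into the defect of the morphism relation and the insertions of m' into
    -- f. The two contributions Q(insertions) cancel, leaving Q(`fullSum`) + S = 0.
    have h1 : blockInsertion τ m f (fullSum m f) L =
        blockInsertion τ m f (fun B => (fullSum m f B - insertion τ' f m' B) +
          insertion τ' f m' B) L := by
      simp
    rw [h0, blockInsertion_add, blockInsertion_eq,
      blockInsertion_insertion fun B hB => hτ B fun x hx => hL x (hB hx)] at h1
    · simp only [fullSum_eq hm0 hf0, splitSum_add] at h1
      rw [← hS] at h1
      simp only [← map_splitSum] at h1
      rw [← insertion, map_sub, map_add, hQQ _ (hq L hL)] at h1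
      rw [h1]
      abel
    · intro A B D h hlt
      rw [ih B (fun x hx => hL x (by rw [← h]; simp [hx])) hlt, sub_self]
  -- The ι-part of f sees a single argument only when m' is applied to all of L; the remaining part
  -- is −Q⁺ of S.
  have hins : insertion τ' f m' L = ι (m'.eval L) - Qp S := by
    have h1 : insertion τ' f m' L = splitSum L (fun A R => splitSum R (fun B D =>
        (if (A.map τ' ++ m'.eval B :: D).length = 1 then ι (A.map τ' ++ m'.eval B :: D).sum
          else 0) + (-Qp) (higherSum m f (A.map τ' ++ m'.eval B :: D)))) := by
      refine splitSum_congr fun A R _ => splitSum_congr fun B D _ => ?_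
      rw [hfX, sub_eq_add_neg, LinearMap.neg_apply]
    rw [h1]
    simp only [splitSum_add, ← map_splitSum]
    rw [← hS, splitSum_splitSum_eq, LinearMap.neg_apply, sub_eq_add_neg]
    · simp
    · intro A B D h hlt
      refine if_neg fun h' => ?_
      simp only [List.length_append, List.length_map, List.length_cons] at h'
      rw [← h, List.length_append, List.length_append] at hlt
      omega
  have hS' : S = -m.lin (higherSum m f L) := (neg_eq_of_add_eq_zero_right hQM).symm
  refine ⟨?_, ?_⟩
  · have e1 := LinearMap.congr_fun hHK (higherSum m f L)
    have e2 : m.lin (if L.length = 1 then ι L.sum else 0) = 0 := by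
      split_ifs
      · exact LinearMap.congr_fun hQι _
      · simp
    simp only [LinearMap.add_apply, LinearMap.comp_apply, LinearMap.id_apply] at e1
    rw [fullSum_eq hm0 hf0, hins, hm', hS', hfX, map_sub, e2, map_neg]
    nth_rw 1 [← e1]
    abel
  · have : insertion τ' m' m' L = π S := by
      rw [hS]
      simp only [insertion, hm', map_splitSum]
    rw [this, hS', map_neg]
    have := LinearMap.congr_fun hπQ (higherSum m f L)
    simp only [LinearMap.comp_apply, LinearMap.zero_apply] at this
    rw [this, neg_zero]

end Transfer

/-! ### Parity involution and degrees of lists. -/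

section Parity

variable {K : Type*} [Field K] {V W : Type*} [AddCommGroup V] [Module K V]
  [AddCommGroup W] [Module K W]

/-- The parity involution, multiplication by `(-1)^d` on the component of degree `d`. -/
theorem exists_parity (𝒜 : ℤ → Submodule K V) (h𝒜 : DirectSum.IsInternal 𝒜) :
    ∃ τ : V →ₗ[K] V, ∀ (d : ℤ) (x : V), x ∈ 𝒜 d → τ x = (-1 : K) ^ d • x := by
  let e := LinearEquiv.ofBijective (DirectSum.coeLinearMap 𝒜) h𝒜
  refine ⟨DirectSum.toModule K ℤ V (fun d => ((-1 : K) ^ d) • (𝒜 d).subtype) ∘ₗ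
    e.symm.toLinearMap, fun d x hx => ?_⟩
  have : e.symm x = DirectSum.lof K ℤ (fun d => 𝒜 d) d ⟨x, hx⟩ := by
    rw [LinearEquiv.symm_apply_eq]
    exact (DirectSum.coeLinearMap_lof 𝒜 d ⟨x, hx⟩).symm
  simp [this]

/-- The entries of the list are homogeneous, of total degree `e`. -/
def ListDegree (𝒜 : ℤ → Submodule K V) : List V → ℤ → Prop
  | [], e => e = 0
  | x :: L, e => ∃ d, x ∈ 𝒜 d ∧ ListDegree 𝒜 L (e - d)

theorem ListDegree.append {𝒜 : ℤ → Submodule K V} {A B : List V} {e : ℤ}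
    (h : ListDegree 𝒜 (A ++ B) e) : ∃ a b, ListDegree 𝒜 A a ∧ ListDegree 𝒜 B b ∧ a + b = e := by
  induction A generalizing e with
  | nil => exact ⟨0, e, rfl, h, by simp⟩
  | cons x A ih =>
    obtain ⟨d, hx, h⟩ := h
    obtain ⟨a, b, ha, hb, hab⟩ := ih h
    exact ⟨a + d, b, ⟨d, hx, by simpa using ha⟩, hb, by omega⟩

theorem exists_listDegree {𝒜 : ℤ → Submodule K V} {L : List V}
    (h : ∀ x ∈ L, SetLike.IsHomogeneousElem 𝒜 x) : ∃ e, ListDegree 𝒜 L e := by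
  induction L with
  | nil => exact ⟨0, rfl⟩
  | cons x L ih =>
    obtain ⟨d, hd⟩ := h x (by simp)
    obtain ⟨e, he⟩ := ih fun y hy => h y (by simp [hy])
    exact ⟨e + d, d, hd, by simpa using he⟩

theorem listDegree_ofFn {𝒜 : ℤ → Submodule K V} {k : ℕ} (d : Fin k → ℤ) (o : Fin k → V)
    (h : ∀ i, o i ∈ 𝒜 (d i)) : ListDegree 𝒜 (List.ofFn o) (∑ i, d i) := by
  induction k with
  | zero => simp [ListDegree]
  | succ k ih =>
    rw [List.ofFn_succ, Fin.sum_univ_succ]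
    exact ⟨d 0, h 0, by simpa using ih _ _ fun i => h i.succ⟩

theorem ListDegree.exists_degrees {𝒜 : ℤ → Submodule K V} {L : List V} {e : ℤ}
    (h : ListDegree 𝒜 L e) :
    ∃ d : Fin L.length → ℤ, (∀ i, L.get i ∈ 𝒜 (d i)) ∧ ∑ i, d i = e := by
  induction L generalizing e with
  | nil => exact ⟨fun _ => 0, fun i => i.elim0, by simpa [ListDegree] using h.symm⟩
  | cons x L ih =>
    obtain ⟨d₀, hx, h⟩ := h
    obtain ⟨d, hd, hsum⟩ := ih h
    refine ⟨Fin.cons d₀ d, Fin.cases hx hd, ?_⟩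
    refine (Fin.sum_univ_succ (n := L.length) _).trans ?_
    simp [hsum]

theorem Ops.HasDegree.eval_mem {𝒜 : ℤ → Submodule K V} {ℬ : ℤ → Submodule K W} {r : ℤ}
    {m : Ops K V W} (hm : m.HasDegree 𝒜 ℬ r) {L : List V} {e : ℤ} (h : ListDegree 𝒜 L e) :
    m.eval L ∈ ℬ (e + r) := by
  obtain ⟨d, hd, rfl⟩ := h.exists_degrees
  exact hm _ d _ hd

theorem Ops.hasDegree_of_eval {𝒜 : ℤ → Submodule K V} {ℬ : ℤ → Submodule K W} {r : ℤ}
    {m : Ops K V W} (hm : ∀ (L : List V) (e : ℤ), ListDegree 𝒜 L e → m.eval L ∈ ℬ (e + r)) :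
    m.HasDegree 𝒜 ℬ r := by
  intro k d o ho
  rw [← m.eval_ofFn]
  exact hm _ _ (listDegree_ofFn d o ho)

/-- The prefix X is there for the induction, which moves treated entries into it. -/
theorem ListDegree.map_parity {𝒜 : ℤ → Submodule K V} {τ : V →ₗ[K] V}
    (hτ : ∀ (d : ℤ) (x : V), x ∈ 𝒜 d → τ x = (-1 : K) ^ d • x) (m : Ops K V W) (X : List V)
    {L : List V} {e : ℤ} (h : ListDegree 𝒜 L e) :
    m.eval (X ++ L.map τ) = (-1 : K) ^ e • m.eval (X ++ L) := by
  induction L generalizing X e with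
  | nil =>
    obtain rfl : e = 0 := h
    simp
  | cons x L ih =>
    obtain ⟨d, hx, h⟩ := h
    have := ih (X ++ [τ x]) h
    simp only [List.append_assoc, List.singleton_append] at this
    rw [List.map_cons, this, ← Ops.evalAt_apply, hτ d x hx, map_smul, smul_smul,
      ← zpow_add₀ (by simp), sub_add_cancel, Ops.evalAt_apply]

theorem ListDegree.map_eval {𝒜 : ℤ → Submodule K V} {ℬ : ℤ → Submodule K W} {f : Ops K W V}
    {P : List (List W)} {e : ℤ} (h : ListDegree ℬ P.flatten e)
    (hf : ∀ B ∈ P, ∀ b, ListDegree ℬ B b → f.eval B ∈ 𝒜 b) :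
    ListDegree 𝒜 (P.map f.eval) e := by
  induction P generalizing e with
  | nil => exact h
  | cons B P ih =>
    rw [List.flatten_cons] at h
    obtain ⟨a, b, ha, hb, rfl⟩ := h.append
    refine ⟨a, hf B (by simp) a ha, ?_⟩
    rw [add_sub_cancel_left]
    exact ih hb fun C hC => hf C (by simp [hC])

/-- With at least two blocks, each block is shorter than L. Degrees of f are therefore needed on
shorter lists only, as the induction in `explicitMorphism_degree` requires. -/
theorem higherSum_mem {𝒜 : ℤ → Submodule K V} {ℬ : ℤ → Submodule K W} {m : Ops K V V}
    {f : Ops K W V} (hm : m.HasDegree 𝒜 𝒜 1) {L : List W} {e : ℤ} (h : ListDegree ℬ L e)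
    (hf : ∀ B : List W, B.length < L.length → ∀ b, ListDegree ℬ B b → f.eval B ∈ 𝒜 b) :
    higherSum m f L ∈ 𝒜 (e + 1) := by
  refine partSum_mem _ fun P hP hne => ?_
  split_ifs with h2
  · refine hm.eval_mem (ListDegree.map_eval (ℬ := ℬ) (by rwa [hP]) fun B hB => hf B ?_)
    rw [← hP]
    exact length_lt_of_mem_partition h2 hne hB
  · exact zero_mem _

/-- A bilinear identity may be checked on homogeneous elements. -/
theorem bilinear_ext {𝒜 : ℤ → Submodule K V} (h𝒜 : DirectSum.IsInternal 𝒜)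
    {β γ : V →ₗ[K] V →ₗ[K] K}
    (h : ∀ p q a b, a ∈ 𝒜 p → b ∈ 𝒜 q → β a b = γ a b) : β = γ := by
  have htop := h𝒜.submodule_iSup_eq_top
  ext a b
  have ha : a ∈ ⨆ d, 𝒜 d := by rw [htop]; trivial
  have hb : b ∈ ⨆ d, 𝒜 d := by rw [htop]; trivial
  induction ha using Submodule.iSup_induction' with
  | zero => simp
  | add x y _ _ hx hy => simp only [map_add, LinearMap.add_apply, hx, hy]
  | mem p a ha =>
    induction hb using Submodule.iSup_induction' with
    | zero => simp
    | add x y _ _ hx hy => simp only [map_add, hx, hy]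
    | mem q b hb => exact h p q a b ha hb

end Parity

/-! ### Cyclic invariance by moving the root of a tree. -/

section Cyclic

variable {K : Type*} [Field K] {V W : Type*} [AddCommGroup V] [Module K V]
  [AddCommGroup W] [Module K W]

theorem higherSum_cons (m : Ops K V V) (f : Ops K W V) (y : W) (L : List W) :
    higherSum m f (y :: L) = splitSum L (fun A B => partSum B (fun P =>
      if P = [] then 0 else m.eval (f.eval (y :: A) :: P.map f.eval))) := by
  rw [higherSum, partSum_cons_eq]
  refine splitSum_congr fun A B _ => partSum_congr fun P _ _ => ?_
  cases P <;> simp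

theorem higherSum_concat (m : Ops K V V) (f : Ops K W V) (L : List W) (x : W) :
    higherSum m f (L ++ [x]) = splitSum L (fun A B => partSum A (fun P =>
      if P = [] then 0 else m.eval (P.map f.eval ++ [f.eval (B ++ [x])]))) := by
  rw [higherSum, partSum_concat]
  refine splitSum_congr fun A B _ => partSum_congr fun P _ _ => ?_
  cases P <;> simp

/-- Moving the root of the trees from the leaf `x` to the next leaf `y`. -/
theorem splitSum_higherSum_cyclic {m : Ops K V V} {f : Ops K W V} {ω : V →ₗ[K] V →ₗ[K] K}
    {τ : V → V} {p : W → Prop} {q : V → Prop}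
    (hq : ∀ L : List W, (∀ x ∈ L, p x) → q (f.eval L))
    (hcyc : ∀ (x y : V) (L : List V), q x → q y → (∀ z ∈ L, q z) →
      ω x (m.eval (y :: L)) = ω (τ y) (m.eval (L ++ [x])))
    {x y : W} {L : List W} (hx : p x) (hy : p y) (hL : ∀ z ∈ L, p z) :
    splitSum L (fun A R => ω (f.eval (R ++ [x])) (higherSum m f (y :: A))) =
      splitSum L (fun A R => ω (τ (f.eval (y :: A))) (higherSum m f (R ++ [x]))) := by
  simp only [higherSum_cons, higherSum_concat, map_splitSum, map_partSum]
  -- Both sides now run over L = A ++ P.flatten ++ C. The blocks around the vertex are y :: A, those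
  -- of P, and C ++ [x], and `hcyc` rotates them.
  rw [splitSum_assoc L (fun A B R => partSum B (fun P => ω (f.eval (R ++ [x]))
    (if P = [] then 0 else m.eval (f.eval (y :: A) :: P.map f.eval))))]
  refine splitSum_congr fun A R h => splitSum_congr fun B C h' => partSum_congr fun P hP _ => ?_
  subst h h' hP
  split_ifs
  · simp
  · refine hcyc _ _ _ (hq _ ?_) (hq _ ?_) ?_
    · intro z hz
      rcases List.mem_append.mp hz with hz | hz
      · exact hL z (by simp [hz])
      · simpa [List.mem_singleton.mp hz] using hx
    · intro z hz
      rcases List.mem_cons.mp hz with rfl | hz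
      · exact hy
      · exact hL z (by simp [hz])
    · intro z hz
      obtain ⟨B, hB, rfl⟩ := List.mem_map.mp hz
      exact hq B fun w hw => hL w
        (List.mem_append_right _ (List.mem_append_left _ (List.mem_flatten.mpr ⟨B, hB, hw⟩)))

theorem splitSum_sub {α M : Type*} [AddCommGroup M] (L : List α) (g h : List α → List α → M) :
    splitSum L (fun A B => g A B - h A B) = splitSum L g - splitSum L h := by
  rw [eq_sub_iff_add_eq, ← splitSum_add]
  simp

/-- Cyclic invariance of the transferred operations. -/
theorem higherSum_cyclic {m : Ops K V V} {f : Ops K W V} {ω : V →ₗ[K] V →ₗ[K] K}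
    {τ : V →ₗ[K] V} {p : W → Prop} {q : V → Prop} {ι : W →ₗ[K] V} {Qp : V →ₗ[K] V}
    (hq : ∀ L : List W, (∀ x ∈ L, p x) → q (f.eval L))
    (hq' : ∀ L : List W, (∀ x ∈ L, p x) → q (higherSum m f L))
    (hcyc : ∀ (x y : V) (L : List V), q x → q y → (∀ z ∈ L, q z) →
      ω x (m.eval (y :: L)) = ω (τ y) (m.eval (L ++ [x])))
    (hQp : ∀ x y : V, q x → q y → ω (Qp y) x = ω (τ (Qp x)) y)
    (hf1 : ∀ x, f.eval [x] = ι x)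
    (hf2 : ∀ L : List W, 2 ≤ L.length → f.eval L = -Qp (higherSum m f L))
    {x y : W} {L : List W} (hx : p x) (hy : p y) (hL : ∀ z ∈ L, p z) :
    ω (ι x) (higherSum m f (y :: L)) = ω (τ (ι y)) (higherSum m f (L ++ [x])) := by
  have hsingle : ∀ x : W, higherSum m f [x] = 0 := fun x => by simp [higherSum, partSum_cons]
  have hl : ∀ A R : List W, ω (f.eval (R ++ [x])) (higherSum m f (y :: A)) =
      (if R = [] then ω (ι x) (higherSum m f (y :: A)) else 0) -
        ω (Qp (higherSum m f (R ++ [x]))) (higherSum m f (y :: A)) := by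
    intro A R
    by_cases h : R = []
    · subst h
      simp [hf1, hsingle]
    · have := List.length_pos_iff.mpr h
      rw [hf2 _ (by simp; omega), if_neg h]
      simp
  have hr : ∀ A R : List W, ω (τ (f.eval (y :: A))) (higherSum m f (R ++ [x])) =
      (if A = [] then ω (τ (ι y)) (higherSum m f (R ++ [x])) else 0) -
        ω (τ (Qp (higherSum m f (y :: A)))) (higherSum m f (R ++ [x])) := by
    intro A R
    by_cases h : A = []
    · subst h
      simp [hf1, hsingle]
    · have := List.length_pos_iff.mpr h
      rw [hf2 _ (by simp; omega), if_neg h]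
      simp
  have key := splitSum_higherSum_cyclic hq hcyc hx hy hL
  simp only [hl, hr, splitSum_sub] at key
  rw [splitSum_eq_left fun A R _ h => if_neg h, splitSum_eq_right fun A R _ h => if_neg h,
    if_pos rfl, if_pos rfl] at key
  -- An inner edge Q⁺ joining the tree of x to that of y can be read from either end.
  have hedge : splitSum L (fun A R =>
        ω (Qp (higherSum m f (R ++ [x]))) (higherSum m f (y :: A))) =
      splitSum L (fun A R =>
        ω (τ (Qp (higherSum m f (y :: A)))) (higherSum m f (R ++ [x]))) := by
    refine splitSum_congr fun A R h => ?_
    subst h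
    refine hQp _ _ (hq' _ ?_) (hq' _ ?_)
    · intro z hz
      rcases List.mem_cons.mp hz with rfl | hz
      · exact hy
      · exact hL z (by simp [hz])
    · intro z hz
      rcases List.mem_append.mp hz with hz | hz
      · exact hL z (by simp [hz])
      · simpa [List.mem_singleton.mp hz] using hx
  rw [hedge] at key
  exact sub_left_injective key

/-- Cyclic invariance of `m_k`, written for lists of arguments. -/
theorem IsCyclicAInfty.eval_cyclic {𝒜 : ℤ → Submodule K V} {ω : V →ₗ[K] V →ₗ[K] K}
    {m : Ops K V V} (hm : IsCyclicAInfty 𝒜 ω m) {τ : V →ₗ[K] V}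
    (hτ : ∀ (d : ℤ) (x : V), x ∈ 𝒜 d → τ x = (-1 : K) ^ d • x) (x y : V) (L : List V)
    (hx : SetLike.IsHomogeneousElem 𝒜 x) (hy : SetLike.IsHomogeneousElem 𝒜 y)
    (hL : ∀ z ∈ L, SetLike.IsHomogeneousElem 𝒜 z) :
    ω x (m.eval (y :: L)) = ω (τ y) (m.eval (L ++ [x])) := by
  have hall : ∀ i : Fin (L.length + 2), SetLike.IsHomogeneousElem 𝒜 ((x :: y :: L).get i) := by
    intro i
    have := List.get_mem (x :: y :: L) i
    simp only [List.mem_cons] at this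
    rcases this with h | h | h
    · rwa [h]
    · rwa [h]
    · exact hL _ h
  choose d hd using hall
  have h := hm.cyclic (L.length + 1) d (fun i => (x :: y :: L).get i) (by omega) hd
  have e1 : m (L.length + 1) (fun i => (x :: y :: L).get i.succ) = m.eval (y :: L) := rfl
  have e2 : m (L.length + 1) (fun i => (x :: y :: L).get (i.succ + 1)) = m.eval (L ++ [x]) := by
    symm
    refine m.eval_eq (by simp) _ fun i hi => ?_
    have hi' : i < L.length + 1 := by simpa using hi
    -- Only at the last index does `i.succ + 1` wrap around to 0, which puts x at the end.
    rcases Nat.lt_succ_iff_lt_or_eq.mp hi' with h | rfl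
    · have : ((⟨i, hi'⟩ : Fin (L.length + 1)).succ + 1 : Fin (L.length + 2)) =
          ⟨i + 2, by omega⟩ := by
        ext
        simp [Fin.val_add, Nat.mod_eq_of_lt (show i + 1 + 1 < L.length + 2 by omega)]
      rw [this, List.getElem_append_left h]
      rfl
    · have : ((⟨L.length, hi'⟩ : Fin (L.length + 1)).succ + 1 : Fin (L.length + 2)) = 0 := by
        ext
        simp [Fin.val_add]
      rw [this]
      simp
  rw [e1, e2] at h
  have hy' : τ y = (-1 : K) ^ d 1 • y := hτ _ _ (hd 1)
  rw [hy', map_smul, LinearMap.smul_apply]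
  exact h

end Cyclic

/-! ### The explicit maps evaluated on lists. -/

section ExplicitModel

variable {K : Type*} [Field K] {V W : Type*} [AddCommGroup V] [Module K V]
  [AddCommGroup W] [Module K W]

theorem sum_subtype_compAlong {U : Type*} [AddCommGroup U] [Module K U] (g : Ops K V U)
    (f : Ops K W V) (L : List W) :
    (∑ c : {c : Composition L.length // 2 ≤ c.length},
      compAlong c.1 (g c.1.length) (fun i => f (c.1.blocksFun i))) L.get =
      partSum L (fun P => if 2 ≤ P.length then g.eval (P.map f.eval) else 0) := by
  rw [← sum_compAlong g f (fun k => 2 ≤ k) L.get rfl (fun _ _ => rfl), sum_apply,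
    ← Finset.sum_filter]
  exact (Finset.sum_subtype (Finset.univ.filter fun c : Composition L.length => 2 ≤ c.length)
    (by simp) fun c => compAlong c (g c.length) (fun i => f (c.blocksFun i)) L.get).symm

theorem explicitMorphism_eval_nil (m : Ops K V V) (ι : W →ₗ[K] V) (Qp : V →ₗ[K] V) :
    (explicitMorphism m ι Qp).eval [] = 0 := by
  simp only [Ops.eval, List.length_nil]
  rw [explicitMorphism]
  rfl

theorem explicitMorphism_lin (m : Ops K V V) (ι : W →ₗ[K] V) (Qp : V →ₗ[K] V) :
    (explicitMorphism m ι Qp).lin = ι := by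
  rw [Ops.lin, explicitMorphism, Equiv.symm_apply_apply]

theorem explicitMorphism_eval_singleton (m : Ops K V V) (ι : W →ₗ[K] V) (Qp : V →ₗ[K] V) (x : W) :
    (explicitMorphism m ι Qp).eval [x] = ι x := by
  rw [Ops.eval_singleton, explicitMorphism_lin]

theorem explicitMorphism_eval (m : Ops K V V) (ι : W →ₗ[K] V) (Qp : V →ₗ[K] V) (L : List W)
    (hL : 2 ≤ L.length) : (explicitMorphism m ι Qp).eval L =
      -Qp (higherSum m (explicitMorphism m ι Qp) L) := by
  match L, hL with
  | x :: y :: L, _ =>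
    rw [higherSum, ← sum_subtype_compAlong, Ops.eval]
    simp only [List.length_cons]
    rw [explicitMorphism]
    rfl

theorem explicitMinimalModel_eval (m : Ops K V V) (ι : W →ₗ[K] V) (π : V →ₗ[K] W)
    (Qp : V →ₗ[K] V) (L : List W) : (explicitMinimalModel m ι π Qp).eval L =
      π (higherSum m (explicitMorphism m ι Qp) L) := by
  rw [higherSum, ← sum_subtype_compAlong]
  rfl

theorem explicitMinimalModel_lin (m : Ops K V V) (ι : W →ₗ[K] V) (π : V →ₗ[K] W)
    (Qp : V →ₗ[K] V) : (explicitMinimalModel m ι π Qp).lin = 0 := by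
  ext x
  rw [← Ops.eval_singleton, explicitMinimalModel_eval]
  simp [higherSum, partSum_cons]

theorem Ops.apply_fin_zero (f : Ops K V W) (h : f.eval [] = 0) : f 0 = 0 := by
  ext v
  rw [← f.eval_ofFn]
  simpa using h

theorem explicitMorphism_degree {𝒜 : ℤ → Submodule K V} {ℬ : ℤ → Submodule K W} {m : Ops K V V}
    {ι : W →ₗ[K] V} {Qp : V →ₗ[K] V} (hm : m.HasDegree 𝒜 𝒜 1) (hι : LinHasDegree ℬ 𝒜 0 ι)
    (hQp : LinHasDegree 𝒜 𝒜 (-1) Qp) {L : List W} {e : ℤ} (h : ListDegree ℬ L e) :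
    (explicitMorphism m ι Qp).eval L ∈ 𝒜 e := by
  induction hn : L.length using Nat.strong_induction_on generalizing L e with
  | _ n ih =>
    match L, hn with
    | [], _ => rw [explicitMorphism_eval_nil]; exact zero_mem _
    | [x], _ =>
      rw [explicitMorphism_eval_singleton]
      obtain ⟨d, hx, he⟩ := h
      obtain rfl : e = d := by
        have : e - d = 0 := he
        omega
      simpa using hι _ _ hx
    | x :: y :: L, hn =>
      rw [explicitMorphism_eval _ _ _ _ (by simp)]
      have := hQp _ _ (higherSum_mem hm h fun B hB b hb => ih _ (hn ▸ hB) hb rfl)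
      rw [add_neg_cancel_right] at this
      exact neg_mem this

end ExplicitModel

/-! ### Consequences of the decomposition and of compatibility with the form. -/

section HodgeKodaira

variable {K : Type*} [Field K] {V W : Type*} [AddCommGroup V] [Module K V]
  [AddCommGroup W] [Module K W]
variable {𝒜 : ℤ → Submodule K V} {ℬ : ℤ → Submodule K W} {ω : V →ₗ[K] V →ₗ[K] K} {m : Ops K V V}
  {ι : W →ₗ[K] V} {π : V →ₗ[K] W} {Q Qp : V →ₗ[K] V}

theorem IsHodgeKodaira.apply (h : IsHodgeKodaira 𝒜 ℬ Q ι π Qp) (x : V) :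
    Q (Qp x) + Qp (Q x) + ι (π x) = x :=
  LinearMap.congr_fun h.decomposition x

/-- If ιw = Qv then w = πιw = πQv = 0; and a cycle v differs from ιπv by the boundary QQ⁺v. -/
theorem IsHodgeKodaira.inducesCohomologyIso (h : IsHodgeKodaira 𝒜 ℬ Q ι π Qp) :
    InducesCohomologyIso 0 Q ι := by
  refine ⟨by rw [h.Q_ι, LinearMap.comp_zero], ?_, ?_⟩
  · rw [injective_iff_map_eq_zero]
    intro x
    obtain ⟨⟨w, hw⟩, rfl⟩ := Submodule.Quotient.mk_surjective _ x
    intro hx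
    obtain ⟨v, hv⟩ := (Submodule.Quotient.mk_eq_zero _).mp hx
    have hv' : Q v = ι w := hv
    have h1 : π (ι w) = w := LinearMap.congr_fun h.π_ι w
    have h2 : π (Q v) = 0 := LinearMap.congr_fun h.π_Q v
    rw [Submodule.Quotient.mk_eq_zero]
    refine ⟨0, ?_⟩
    change (0 : W) = w
    rw [← h1, ← hv', h2]
  · intro y
    obtain ⟨⟨v, hv⟩, rfl⟩ := Submodule.Quotient.mk_surjective _ y
    refine ⟨Submodule.Quotient.mk ⟨π v, by simp⟩, ?_⟩
    refine (Submodule.Quotient.eq _).mpr ⟨-Qp v, ?_⟩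
    change Q (-Qp v) = ι (π v) - v
    have h1 := h.apply v
    rw [LinearMap.mem_ker.mp hv, map_zero, add_zero] at h1
    nth_rw 3 [← h1]
    rw [map_neg]
    abel

/-- Since Q⁺QQ⁺ = Q⁺, every value of Q⁺ lies in H^u. -/
theorem IsCompatible.Qp_Qp (h : IsHodgeKodaira 𝒜 ℬ Q ι π Qp) (hω : IsCompatible ω Q ι π Qp)
    (x y : V) : ω (Qp x) (Qp y) = 0 :=
  hω.2 _ ⟨Qp x, LinearMap.congr_fun h.image x⟩ _ ⟨Qp y, LinearMap.congr_fun h.image y⟩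

theorem IsCompatible.ι_Qp (h : IsHodgeKodaira 𝒜 ℬ Q ι π Qp) (hω : IsCompatible ω Q ι π Qp)
    (w : W) (y : V) : ω (ι w) (Qp y) = 0 :=
  hω.1 _ ⟨ι w, congrArg ι (LinearMap.congr_fun h.π_ι w)⟩ _ ⟨Qp y, LinearMap.congr_fun h.image y⟩

theorem IsCompatible.Qp_ι (h : IsHodgeKodaira 𝒜 ℬ Q ι π Qp) (hω : IsCompatible ω Q ι π Qp)
    (hs : IsOddSymplectic 𝒜 ω) (w : W) (y : V) : ω (Qp y) (ι w) = 0 := by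
  rw [hs.skew, hω.ι_Qp h, neg_zero]

/-- The differential is skew with respect to the form, up to the parity involution. -/
theorem IsCyclicAInfty.lin_skew (h𝒜 : DirectSum.IsInternal 𝒜) (hm : IsCyclicAInfty 𝒜 ω m)
    {τ : V →ₗ[K] V} (hτ : ∀ (d : ℤ) (x : V), x ∈ 𝒜 d → τ x = (-1 : K) ^ d • x) (a b : V) :
    ω a (m.lin b) = ω (τ b) (m.lin a) := by
  have : ω.compl₂ m.lin = (ω.compl₁₂ τ m.lin).flip := by
    refine bilinear_ext h𝒜 fun p q a b ha hb => ?_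
    have := hm.eval_cyclic hτ a b [] ⟨p, ha⟩ ⟨q, hb⟩ (by simp)
    simpa [Ops.eval_singleton] using this
  exact LinearMap.congr_fun₂ this a b

/-- In the decomposition of x, the part Q⁺Qx is orthogonal to ιw by compatibility, and QQ⁺x because
Q can be moved onto ιw, where it vanishes. -/
theorem form_ι_projection (h𝒜 : DirectSum.IsInternal 𝒜) (hm : IsCyclicAInfty 𝒜 ω m)
    (h : IsHodgeKodaira 𝒜 ℬ m.lin ι π Qp) (hω : IsCompatible ω m.lin ι π Qp) (w : W) (x : V) :
    ω (ι w) (ι (π x)) = ω (ι w) x := by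
  obtain ⟨τ, hτ⟩ := exists_parity 𝒜 h𝒜
  have h1 : m.lin (ι w) = 0 := LinearMap.congr_fun h.Q_ι w
  conv_rhs => rw [← h.apply x]
  rw [map_add, map_add, hω.ι_Qp h, hm.lin_skew h𝒜 hτ, h1, map_zero, add_zero, zero_add]

/-- Against a vector of H^u only the component QQ⁺ of the other argument counts. Hence ω(Q⁺y, x) =
ω(Q⁺y, QQ⁺x); moving Q across gives ω(τQ⁺x, QQ⁺y), and this is ω(τQ⁺x, y). -/
theorem form_Qp_left (h𝒜 : DirectSum.IsInternal 𝒜) (hm : IsCyclicAInfty 𝒜 ω m)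
    (h : IsHodgeKodaira 𝒜 ℬ m.lin ι π Qp) (hω : IsCompatible ω m.lin ι π Qp)
    {τ : V →ₗ[K] V} (hτ : ∀ (d : ℤ) (x : V), x ∈ 𝒜 d → τ x = (-1 : K) ^ d • x)
    (x y : V) (hx : SetLike.IsHomogeneousElem 𝒜 x) : ω (Qp y) x = ω (τ (Qp x)) y := by
  obtain ⟨d, hd⟩ := hx
  have h1 : ∀ a b, ω (Qp a) b = ω (Qp a) (m.lin (Qp b)) := by
    intro a b
    conv_lhs => rw [← h.apply b]
    rw [map_add, map_add, hω.Qp_Qp h, hω.Qp_ι h hm.symplectic, add_zero, add_zero]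
  rw [h1 y x, hm.lin_skew h𝒜 hτ, hτ _ _ (h.degree_Qp d x hd), map_smul, LinearMap.smul_apply,
    LinearMap.smul_apply, ← h1]

theorem isOddSymplectic_restrict (h𝒜 : DirectSum.IsInternal 𝒜) (hm : IsCyclicAInfty 𝒜 ω m)
    (h : IsHodgeKodaira 𝒜 ℬ m.lin ι π Qp) (hω : IsCompatible ω m.lin ι π Qp) :
    IsOddSymplectic ℬ (ω.compl₁₂ ι ι) where
  degree p q a b ha hb hab := by
    have ha' := h.degree_ι p a ha
    have hb' := h.degree_ι q b hb
    rw [add_zero] at ha' hb'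
    exact hm.symplectic.degree p q _ _ ha' hb' hab
  skew a b := hm.symplectic.skew _ _
  nondegenerate a ha := by
    have hιa : ι a ≠ 0 := fun h0 => ha (by
      rw [← LinearMap.id_apply (R := K) a, ← h.π_ι, LinearMap.comp_apply, h0, map_zero])
    obtain ⟨b, hb⟩ := hm.symplectic.nondegenerate _ hιa
    refine ⟨π b, ?_⟩
    rw [LinearMap.compl₁₂_apply, form_ι_projection h𝒜 hm h hω]
    exact hb

theorem explicitMorphism_preservesForms (hs : IsOddSymplectic 𝒜 ω)
    (h : IsHodgeKodaira 𝒜 ℬ m.lin ι π Qp) (hω : IsCompatible ω m.lin ι π Qp) :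
    PreservesForms (ω.compl₁₂ ι ι) ω (explicitMorphism m ι Qp) where
  linear a b := by rw [explicitMorphism_lin]; rfl
  higher n o hn := by
    have hQp : ∀ (k : ℕ) (v : Fin k → W), 2 ≤ k →
        ∃ x, explicitMorphism m ι Qp k v = Qp x := by
      intro k v hk
      rw [← Ops.eval_ofFn, explicitMorphism_eval _ _ _ _ (by simpa using hk), ← map_neg]
      exact ⟨_, rfl⟩
    have hι : ∀ (v : Fin 1 → W), ∃ w, explicitMorphism m ι Qp 1 v = ι w := by
      intro v
      exact ⟨v 0, by rw [← Ops.eval_ofFn]; simp [explicitMorphism_eval_singleton]⟩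
    -- As n ≥ 3, at least one of k and n − k exceeds 1, so one argument lies in H^u and the other in
    -- H^u or in the image of ι.
    refine Finset.sum_eq_zero fun k hk => ?_
    rw [Finset.mem_Icc] at hk
    rcases Nat.lt_or_ge 1 k with hk2 | hk1
    · obtain ⟨x, hx⟩ := hQp k (fun i => o i) hk2
      rw [hx]
      rcases Nat.lt_or_ge 1 (n - k) with hnk | hnk
      · obtain ⟨y, hy⟩ := hQp (n - k) (fun i => o (k + i)) hnk
        rw [hy, hω.Qp_Qp h]
      · have h1 : n - k = 1 := by omega
        rw [h1]
        obtain ⟨y, hy⟩ := hι (fun i => o (k + i))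
        rw [hy, hω.Qp_ι h hs]
    · obtain rfl : k = 1 := by omega
      obtain ⟨x, hx⟩ := hι (fun i => o i)
      obtain ⟨y, hy⟩ := hQp (n - 1) (fun i => o (1 + i)) (by omega)
      rw [hx, hy, hω.ι_Qp h]

end HodgeKodaira

/-! ### The minimal model and its quasi-isomorphism. -/

section MinimalModel

variable {K : Type*} [Field K] {V W : Type*} [AddCommGroup V] [Module K V]
  [AddCommGroup W] [Module K W]
variable {𝒜 : ℤ → Submodule K V} {ℬ : ℤ → Submodule K W} {ω : V →ₗ[K] V →ₗ[K] K} {m : Ops K V V}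
  {ι : W →ₗ[K] V} {π : V →ₗ[K] W} {Qp : V →ₗ[K] V}

/-- The relations of the explicit maps, on lists of homogeneous arguments. -/
theorem explicit_relations (h𝒜 : DirectSum.IsInternal 𝒜) (hm : IsAInfty 𝒜 m)
    (h : IsHodgeKodaira 𝒜 ℬ m.lin ι π Qp) {τ' : W →ₗ[K] W}
    (hτ' : ∀ (d : ℤ) (x : W), x ∈ ℬ d → τ' x = (-1 : K) ^ d • x)
    (L : List W) (hL : ∀ x ∈ L, SetLike.IsHomogeneousElem ℬ x) :
    fullSum m (explicitMorphism m ι Qp) L =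
        insertion τ' (explicitMorphism m ι Qp) (explicitMinimalModel m ι π Qp) L ∧
      insertion τ' (explicitMinimalModel m ι π Qp) (explicitMinimalModel m ι π Qp) L = 0 := by
  obtain ⟨τ, hτ⟩ := exists_parity 𝒜 h𝒜
  have hm0 : m.eval [] = 0 := by
    simp only [Ops.eval, List.length_nil]
    rw [hm.zero]
    rfl
  have hdeg : ∀ (L : List W) (e : ℤ), ListDegree ℬ L e →
      (explicitMorphism m ι Qp).eval L ∈ 𝒜 e := fun L e =>
    explicitMorphism_degree hm.degree h.degree_ι h.degree_Qp
  refine transfer (τ := τ) (SetLike.IsHomogeneousElem ℬ) (SetLike.IsHomogeneousElem 𝒜) hm0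
    (explicitMorphism_eval_nil m ι Qp) (explicitMorphism_eval_singleton m ι Qp)
    (explicitMorphism_eval m ι Qp) (explicitMinimalModel_eval m ι π Qp) ?_ ?_ ?_ h.Q_ι h.π_Q
    h.decomposition L hL
  · intro L hL
    obtain ⟨e, he⟩ := exists_listDegree hL
    rw [hτ _ _ (hdeg L e he)]
    exact he.map_parity hτ' _ []
  · intro L hL
    obtain ⟨e, he⟩ := exists_listDegree hL
    exact ⟨e, hdeg L e he⟩
  · intro L hL
    rcases Nat.eq_zero_or_pos L.length with h0 | hpos
    · obtain rfl := List.length_eq_zero_iff.mp h0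
      simp [insertion, hm0, Ops.eval_singleton]
    -- The relation is stated for infinite sequences, so the list is padded with zeros, which are
    -- homogeneous.
    · have hall : ∀ i : ℕ, SetLike.IsHomogeneousElem 𝒜 (L.getD i 0) := by
        intro i
        by_cases hi : i < L.length
        · rw [List.getD_eq_getElem _ _ hi]
          exact hL _ (List.getElem_mem hi)
        · rw [List.getD_eq_default _ _ (by omega)]
          exact ⟨0, zero_mem _⟩
      choose d hd using hall
      have key := insertSum_eq_insertion hτ m m hm.zero L.length d _ hd
      rw [hm.relation _ d _ hpos hd] at key
      have : List.ofFn (fun i : Fin L.length => L.getD i 0) = L :=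
        List.ext_getElem (by simp) (by simp)
      rw [this] at key
      exact key.symm

theorem explicitMinimalModel_isAInfty (h𝒜 : DirectSum.IsInternal 𝒜) (hℬ : DirectSum.IsInternal ℬ)
    (hm : IsAInfty 𝒜 m) (h : IsHodgeKodaira 𝒜 ℬ m.lin ι π Qp) :
    IsAInfty ℬ (explicitMinimalModel m ι π Qp) := by
  have hzero : explicitMinimalModel m ι π Qp 0 = 0 := Ops.apply_fin_zero _ (by
    rw [explicitMinimalModel_eval]
    simp [higherSum])
  refine ⟨Ops.hasDegree_of_eval fun L e he => ?_, hzero, fun n d o _ ho => ?_⟩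
  · rw [explicitMinimalModel_eval]
    have := h.degree_π _ _ (higherSum_mem (f := explicitMorphism m ι Qp) hm.degree he
      fun B _ b hb => explicitMorphism_degree hm.degree h.degree_ι h.degree_Qp hb)
    rwa [add_zero] at this
  · obtain ⟨τ', hτ'⟩ := exists_parity ℬ hℬ
    rw [insertSum_eq_insertion hτ' _ _ hzero n d o ho]
    refine (explicit_relations h𝒜 hm h hτ' _ fun x hx => ?_).2
    obtain ⟨i, rfl⟩ := List.mem_ofFn.mp hx
    exact ⟨_, ho i⟩

theorem explicitMorphism_isAInftyQuasiIso (h𝒜 : DirectSum.IsInternal 𝒜)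
    (hℬ : DirectSum.IsInternal ℬ) (hm : IsAInfty 𝒜 m) (h : IsHodgeKodaira 𝒜 ℬ m.lin ι π Qp) :
    IsAInftyQuasiIso ℬ (explicitMinimalModel m ι π Qp) 𝒜 m (explicitMorphism m ι Qp) where
  degree := Ops.hasDegree_of_eval fun L e he => by
    rw [add_zero]
    exact explicitMorphism_degree hm.degree h.degree_ι h.degree_Qp he
  zero := Ops.apply_fin_zero _ (explicitMorphism_eval_nil m ι Qp)
  relation n d o _ ho := by
    obtain ⟨τ', hτ'⟩ := exists_parity ℬ hℬ
    rw [insertSum_eq_insertion hτ' _ _ (explicitMinimalModel_isAInfty h𝒜 hℬ hm h).zero n d o ho]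
    have hsum := sum_compAlong m (explicitMorphism m ι Qp) (fun _ => True)
      (fun i : Fin n => o i) (L := List.ofFn fun i : Fin n => o i) (by simp) (by simp)
    simp only [if_true] at hsum
    rw [hsum]
    refine (explicit_relations h𝒜 hm h hτ' _ fun x hx => ?_).1
    obtain ⟨i, rfl⟩ := List.mem_ofFn.mp hx
    exact ⟨_, ho i⟩
  quasiIso := by
    rw [explicitMinimalModel_lin, explicitMorphism_lin]
    exact h.inducesCohomologyIso

theorem explicitMinimalModel_isCyclicAInfty (h𝒜 : DirectSum.IsInternal 𝒜)
    (hℬ : DirectSum.IsInternal ℬ) (hm : IsCyclicAInfty 𝒜 ω m)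
    (h : IsHodgeKodaira 𝒜 ℬ m.lin ι π Qp) (hω : IsCompatible ω m.lin ι π Qp) :
    IsCyclicAInfty ℬ (ω.compl₁₂ ι ι) (explicitMinimalModel m ι π Qp) where
  toIsAInfty := explicitMinimalModel_isAInfty h𝒜 hℬ hm.toIsAInfty h
  symplectic := isOddSymplectic_restrict h𝒜 hm h hω
  cyclic k d o hk ho := by
    obtain ⟨τ, hτ⟩ := exists_parity 𝒜 h𝒜
    obtain ⟨l, rfl⟩ : ∃ l, k = l + 1 := ⟨k - 1, by omega⟩
    set L : List W := List.ofFn (fun i : Fin l => o i.succ.succ) with hLdef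
    have hdeg : ∀ (L : List W) (e : ℤ), ListDegree ℬ L e →
        (explicitMorphism m ι Qp).eval L ∈ 𝒜 e := fun L e =>
      explicitMorphism_degree hm.degree h.degree_ι h.degree_Qp
    have key := higherSum_cyclic (m := m) (f := explicitMorphism m ι Qp) (ω := ω) (τ := τ)
      (p := SetLike.IsHomogeneousElem ℬ) (q := SetLike.IsHomogeneousElem 𝒜) (ι := ι) (Qp := Qp)
      (fun L hL => by
        obtain ⟨e, he⟩ := exists_listDegree hL
        exact ⟨e, hdeg L e he⟩)
      (fun L hL => by
        obtain ⟨e, he⟩ := exists_listDegree hL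
        exact ⟨e + 1, higherSum_mem hm.degree he fun B _ b => hdeg B b⟩)
      (hm.eval_cyclic hτ) (fun x y hx _ => form_Qp_left h𝒜 hm h hω hτ x y hx)
      (explicitMorphism_eval_singleton m ι Qp) (explicitMorphism_eval m ι Qp)
      (x := o 0) (y := o 1) (L := L) ⟨_, ho 0⟩ ⟨_, ho 1⟩ (by
        intro z hz
        obtain ⟨i, rfl⟩ := List.mem_ofFn.mp hz
        exact ⟨_, ho _⟩)
    have hι1 := h.degree_ι _ _ (ho 1)
    rw [add_zero] at hι1
    -- Since ι has degree 0, τ(ι o_1) carries exactly the sign of o_1; inserting ιπ in the second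
    -- slots turns the sums into the transferred operations.
    rw [hτ _ _ hι1, map_smul, LinearMap.smul_apply, smul_eq_mul,
      ← form_ι_projection h𝒜 hm h hω, ← form_ι_projection h𝒜 hm h hω (o 1),
      ← explicitMinimalModel_eval, ← explicitMinimalModel_eval] at key
    have e1 : (explicitMinimalModel m ι π Qp).eval (o 1 :: L) =
        explicitMinimalModel m ι π Qp (l + 1) (fun i => o i.succ) := by
      refine Ops.eval_eq _ (by simp [hLdef]) _ fun i hi => ?_
      cases i with
      | zero => rfl
      | succ i => simp [hLdef]
    have e2 : (explicitMinimalModel m ι π Qp).eval (L ++ [o 0]) =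
        explicitMinimalModel m ι π Qp (l + 1) (fun i => o (i.succ + 1)) := by
      refine Ops.eval_eq _ (by simp [hLdef]) _ fun i hi => ?_
      have hi' : i < l + 1 := by simpa [hLdef] using hi
      rcases Nat.lt_succ_iff_lt_or_eq.mp hi' with hlt | rfl
      · rw [List.getElem_append_left (by simpa [hLdef] using hlt)]
        simp only [hLdef, List.getElem_ofFn]
        congr 1
        ext
        simp [Fin.val_add, Nat.mod_eq_of_lt (show i + 1 + 1 < l + 1 + 1 by omega)]
      · rw [List.getElem_append_right (by simp [hLdef])]
        simp only [hLdef, List.length_ofFn, Nat.sub_self, List.getElem_cons_zero]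
        congr 1
        ext
        simp [Fin.val_add]
    rw [e1, e2] at key
    exact key

end MinimalModel
end AInfinity

theorem lemma4p13 {K : Type*} [Field K] [CharZero K]
    {H Hp : Type*} [AddCommGroup H] [Module K H] [AddCommGroup Hp] [Module K Hp]
    (𝒜 : ℤ → Submodule K H) (h𝒜 : DirectSum.IsInternal 𝒜)
    (ℬ : ℤ → Submodule K Hp) (hℬ : DirectSum.IsInternal ℬ)
    (ω : H →ₗ[K] H →ₗ[K] K) (m : AInfinity.Ops K H H)
    (hm : AInfinity.IsCyclicAInfty 𝒜 ω m)
    (ι : Hp →ₗ[K] H) (π : H →ₗ[K] Hp) (Qp : H →ₗ[K] H)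
    (hHK : AInfinity.IsHodgeKodaira 𝒜 ℬ m.lin ι π Qp)
    (hω : AInfinity.IsCompatible ω m.lin ι π Qp) :
    (AInfinity.IsCyclicAInfty ℬ (ω.compl₁₂ ι ι) (AInfinity.explicitMinimalModel m ι π Qp) ∧
      AInfinity.IsMinimal (AInfinity.explicitMinimalModel m ι π Qp)) ∧
    AInfinity.IsCyclicAInftyQuasiIso ℬ (ω.compl₁₂ ι ι) (AInfinity.explicitMinimalModel m ι π Qp)
      𝒜 ω m (AInfinity.explicitMorphism m ι Qp) := by
  have hcyc := AInfinity.explicitMinimalModel_isCyclicAInfty h𝒜 hℬ hm hHK hω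
  exact ⟨⟨hcyc, AInfinity.explicitMinimalModel_lin m ι π Qp⟩,
    { toIsAInftyQuasiIso :=
        AInfinity.explicitMorphism_isAInftyQuasiIso h𝒜 hℬ hm.toIsAInfty hHK
      source := hcyc
      target := hm
      forms := AInfinity.explicitMorphism_preservesForms hm.symplectic hHK hω }⟩
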